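/- A string is a square if it has the form $xx$ for a nonempty string $x$, and it is squarefree if none of its (contiguous) substrings is a square. The computational model is a unit-cost random access machine over an unordered alphabet: a program is a finite while-program that uses finitely many integer variables, integer arrays, letter variables and letter arrays; its integers are nonnegative, with addition, (truncated) subtraction, multiplication, integer division, remainder and comparison; letters are atomic objects that can only be copied, stored and tested for equality. A program does not depend on the alphabet or on the length of the input. An online algorithm consists of a start command and of a step command that is executed once after each input letter, without knowledge of the later letters; after every step it gives a yes/no answer. Theorem. There are a single online algorithm of this kind and a constant $C$ such that for every alphabet $\Sigma$ (finite or infinite) and every string $w$ over $\Sigma$, with $n=|w|$: when the algorithm has read the letters of $w$ one by one from left to right and has finished the work on the last of them, its answer is "yes" if and only if $w$ is squarefree (thus every prefix of an input string is decided correctly immediately after its rightmost letter is read); it has then performed at most $C\,n\log n$ operations in total if $n\ge 2$; and up to that moment it has used linear space, that is, all array indices have been less than $C(n+1)$ and all integers less than $(n+2)^C$ (so that every integer fits into a machine word of $O(\log n)$ bits). -/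

import Mathlib

namespace OnlineSquares

/-! ### Squares -/

/-- A word is a square if it is `x ++ x` for a nonempty word `x`. -/
def IsSquareWord {α : Type*} (w : List α) : Prop :=
  ∃ x : List α, x ≠ [] ∧ w = x ++ x

/-- A word is squarefree if none of its substrings (contiguous factors) is a square. -/
def SquarefreeWord {α : Type*} (w : List α) : Prop :=
  ∀ v : List α, v <:+: w → ¬ IsSquareWord v

/-! ### A random access machine over an unordered alphabet

Programs are finite while-programs over finitely many integer variables, integer arrays, letter
variables and letter arrays (all of them named by natural numbers). Letters are atomic: a program
can copy them and test two of them for equality, nothing else; no letter occurs in a program and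
no letter is ever turned into a number. A program does not mention the alphabet at all. -/

/-- Arithmetic operations on nonnegative integers. -/
inductive BinOp where
  | add | sub | mul | div | mod

/-- Subtraction is truncated, division is rounded down (`a / 0 = 0`, `a % 0 = a`). -/
def BinOp.eval : BinOp → ℕ → ℕ → ℕ
  | .add, a, b => a + b
  | .sub, a, b => a - b
  | .mul, a, b => a * b
  | .div, a, b => a / b
  | .mod, a, b => a % b

/-- Integer expressions: constants, integer variables, array entries `A[e]`, arithmetic. -/
inductive Expr where
  | lit (c : ℕ)
  | var (x : ℕ)
  | get (A : ℕ) (i : Expr)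
  | bin (op : BinOp) (a b : Expr)

/-- Letter expressions: letter variables and letter array entries `L[e]`. -/
inductive LExpr where
  | var (x : ℕ)
  | get (L : ℕ) (i : Expr)

/-- Tests: order and equality of integers, equality of letters, Boolean combinations. -/
inductive Test where
  | lt (a b : Expr)
  | eq (a b : Expr)
  | leq (a b : LExpr)
  | not (t : Test)
  | and (t u : Test)

/-- Commands. `assign` and `store` write an integer variable, resp. an integer array entry;
`lassign` and `lstore` do the same for letters. -/
inductive Cmd where
  | skip
  | assign (x : ℕ) (e : Expr)
  | store (A : ℕ) (i e : Expr)
  | lassign (x : ℕ) (l : LExpr)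
  | lstore (L : ℕ) (i : Expr) (l : LExpr)
  | seq (c d : Cmd)
  | ite (t : Test) (c d : Cmd)
  | while (t : Test) (c : Cmd)

/-- Contents of the memory. A letter cell holds a letter, or `none` while it has not been
written. -/
structure State (α : Type*) where
  var : ℕ → ℕ
  arr : ℕ → ℕ → ℕ
  lvar : ℕ → Option α
  larr : ℕ → ℕ → Option α

/-- The initial memory. -/
def State.blank (α : Type*) : State α where
  var _ := 0
  arr _ _ := 0
  lvar _ := none
  larr _ _ := none

def State.setVar {α : Type*} (s : State α) (x v : ℕ) : State α :=
  { s with var := Function.update s.var x v }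

def State.setArr {α : Type*} (s : State α) (A i v : ℕ) : State α :=
  { s with arr := Function.update s.arr A (Function.update (s.arr A) i v) }

def State.setLVar {α : Type*} (s : State α) (x : ℕ) (a : Option α) : State α :=
  { s with lvar := Function.update s.lvar x a }

def State.setLArr {α : Type*} (s : State α) (L i : ℕ) (a : Option α) : State α :=
  { s with larr := Function.update s.larr L (Function.update (s.larr L) i a) }

/-- Value of an integer expression. -/
def Expr.eval {α : Type*} (s : State α) : Expr → ℕ
  | .lit c => c
  | .var x => s.var x
  | .get A i => s.arr A (i.eval s)
  | .bin op a b => op.eval (a.eval s) (b.eval s)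

/-- Value of a letter expression. -/
def LExpr.eval {α : Type*} (s : State α) : LExpr → Option α
  | .var x => s.lvar x
  | .get L i => s.larr L (i.eval s)

/-- Truth of a test. Two letter cells are equal if they have the same content. -/
def Test.Holds {α : Type*} (s : State α) : Test → Prop
  | .lt a b => a.eval s < b.eval s
  | .eq a b => a.eval s = b.eval s
  | .leq a b => a.eval s = b.eval s
  | .not t => ¬ t.Holds s
  | .and t u => t.Holds s ∧ u.Holds s

/-- Number of operations in the evaluation of an integer expression (one for each access to a
variable or to an array entry, for each constant, and for each arithmetic operation). -/
def Expr.cost : Expr → ℕ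
  | .lit _ => 1
  | .var _ => 1
  | .get _ i => i.cost + 1
  | .bin _ a b => a.cost + b.cost + 1

/-- Number of operations in the evaluation of a letter expression. -/
def LExpr.cost : LExpr → ℕ
  | .var _ => 1
  | .get _ i => i.cost + 1

/-- Number of operations in the evaluation of a test. -/
def Test.cost : Test → ℕ
  | .lt a b => a.cost + b.cost + 1
  | .eq a b => a.cost + b.cost + 1
  | .leq a b => a.cost + b.cost + 1
  | .not t => t.cost + 1
  | .and t u => t.cost + u.cost + 1

/-- The evaluation respects the resource limits: every array index is less than `M`, and every
number that occurs is less than `W`. -/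
def Expr.Within {α : Type*} (M W : ℕ) (s : State α) : Expr → Prop
  | .lit c => c < W
  | .var x => s.var x < W
  | .get A i => i.Within M W s ∧ i.eval s < M ∧ s.arr A (i.eval s) < W
  | .bin op a b => a.Within M W s ∧ b.Within M W s ∧ op.eval (a.eval s) (b.eval s) < W

def LExpr.Within {α : Type*} (M W : ℕ) (s : State α) : LExpr → Prop
  | .var _ => True
  | .get _ i => i.Within M W s ∧ i.eval s < M

def Test.Within {α : Type*} (M W : ℕ) (s : State α) : Test → Prop
  | .lt a b => a.Within M W s ∧ b.Within M W s
  | .eq a b => a.Within M W s ∧ b.Within M W s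
  | .leq a b => a.Within M W s ∧ b.Within M W s
  | .not t => t.Within M W s
  | .and t u => t.Within M W s ∧ u.Within M W s

/-- `Exec M W c s s' t`: started in the memory state `s`, the command `c` terminates in the state
`s'` after exactly `t` operations, and during the whole execution every array has size at most
`M` and every integer is less than `W`. The limits are invisible to the program: an execution
that violates them just does not count. -/
inductive Exec {α : Type*} (M W : ℕ) : Cmd → State α → State α → ℕ → Prop
  | skip (s : State α) : Exec M W .skip s s 1
  | assign (s : State α) (x : ℕ) (e : Expr) (he : e.Within M W s) :
      Exec M W (.assign x e) s (s.setVar x (e.eval s)) (e.cost + 1)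
  | store (s : State α) (A : ℕ) (i e : Expr) (hi : i.Within M W s) (hM : i.eval s < M)
      (he : e.Within M W s) :
      Exec M W (.store A i e) s (s.setArr A (i.eval s) (e.eval s)) (i.cost + e.cost + 1)
  | lassign (s : State α) (x : ℕ) (l : LExpr) (hl : l.Within M W s) :
      Exec M W (.lassign x l) s (s.setLVar x (l.eval s)) (l.cost + 1)
  | lstore (s : State α) (L : ℕ) (i : Expr) (l : LExpr) (hi : i.Within M W s)
      (hM : i.eval s < M) (hl : l.Within M W s) :
      Exec M W (.lstore L i l) s (s.setLArr L (i.eval s) (l.eval s)) (i.cost + l.cost + 1)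
  | seq {c d : Cmd} {s s' s'' : State α} {t t' : ℕ} (hc : Exec M W c s s' t)
      (hd : Exec M W d s' s'' t') : Exec M W (.seq c d) s s'' (t + t')
  | ite_true {b : Test} {c d : Cmd} {s s' : State α} {t : ℕ} (hb : b.Within M W s)
      (h : b.Holds s) (hc : Exec M W c s s' t) : Exec M W (.ite b c d) s s' (b.cost + t + 1)
  | ite_false {b : Test} {c d : Cmd} {s s' : State α} {t : ℕ} (hb : b.Within M W s)
      (h : ¬ b.Holds s) (hd : Exec M W d s s' t) : Exec M W (.ite b c d) s s' (b.cost + t + 1)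
  | while_true {b : Test} {c : Cmd} {s s' s'' : State α} {t t' : ℕ} (hb : b.Within M W s)
      (h : b.Holds s) (hc : Exec M W c s s' t) (hw : Exec M W (.while b c) s' s'' t') :
      Exec M W (.while b c) s s'' (b.cost + t + 1 + t')
  | while_false {b : Test} {c : Cmd} {s : State α} (hb : b.Within M W s) (h : ¬ b.Holds s) :
      Exec M W (.while b c) s s (b.cost + 1)

/-- Execution is deterministic; the limits have no influence on the result. -/
theorem Exec.deterministic {α : Type*} {M W M' W' : ℕ} {c : Cmd} {s s₁ s₂ : State α}
    {t₁ t₂ : ℕ} (h₁ : Exec M W c s s₁ t₁) (h₂ : Exec M' W' c s s₂ t₂) : s₁ = s₂ ∧ t₁ = t₂ := by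
  induction h₁ generalizing s₂ t₂ with
  | skip | assign | store | lassign | lstore => cases h₂; exact ⟨rfl, rfl⟩
  | seq _ _ ihc ihd =>
    cases h₂ with
    | seq hc hd =>
      obtain ⟨rfl, rfl⟩ := ihc hc
      obtain ⟨rfl, rfl⟩ := ihd hd
      exact ⟨rfl, rfl⟩
  | ite_true _ h _ ih =>
    cases h₂ with
    | ite_true _ _ hc => obtain ⟨rfl, rfl⟩ := ih hc; exact ⟨rfl, rfl⟩
    | ite_false _ h' _ => exact absurd h h'
  | ite_false _ h _ ih =>
    cases h₂ with
    | ite_true _ h' _ => exact absurd h' h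
    | ite_false _ _ hd => obtain ⟨rfl, rfl⟩ := ih hd; exact ⟨rfl, rfl⟩
  | while_true _ h _ _ ihc ihw =>
    cases h₂ with
    | while_true _ _ hc hw =>
      obtain ⟨rfl, rfl⟩ := ihc hc
      obtain ⟨rfl, rfl⟩ := ihw hw
      exact ⟨rfl, rfl⟩
    | while_false _ h' => exact absurd h h'
  | while_false _ h =>
    cases h₂ with
    | while_true _ h' _ _ => exact absurd h' h
    | while_false => exact ⟨rfl, rfl⟩

/-! ### Online algorithms -/

/-- An online algorithm: a command `start` that is executed before any input is seen, and a
command `step` that is executed once for each input letter, which is put into the letter variable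
`input` beforehand. The current answer ("yes" if nonzero) stands in the variable `answer`. -/
structure OnlineAlgorithm where
  start : Cmd
  step : Cmd
  input : ℕ
  answer : ℕ

/-- `A.Run M W w s t`: after reading exactly the letters of `w`, one at a time from left to right,
and after the work on the last of them is finished, the memory state of `A` is `s`; `t` operations
have been performed since the beginning (reading a letter is one operation), and the limits `M` on
the sizes of arrays and `W` on integers have been respected all the time. The letters that follow
`w` in a longer input are unknown to `A` at that moment. -/
inductive OnlineAlgorithm.Run (A : OnlineAlgorithm) {α : Type*} (M W : ℕ) :
    List α → State α → ℕ → Prop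
  | nil {s : State α} {t : ℕ} (h : Exec M W A.start (State.blank α) s t) : A.Run M W [] s t
  | snoc {w : List α} {a : α} {s s' : State α} {t t' : ℕ} (h : A.Run M W w s t)
      (h' : Exec M W A.step (s.setLVar A.input (some a)) s' t') :
      A.Run M W (w ++ [a]) s' (t + 1 + t')

end OnlineSquares

/-! The text is stored from cell 1 on; cell 0 stays empty. For every `L = 2 ^ k` the text is cut
into aligned blocks of length `L`. A block at `a = c * L` with `c ≥ 1` is active while the end `n`
of the text satisfies `a < n ≤ a + 8 * L`, so each level has at most eight active blocks. Every
square of period `p` ending at `n` is seen by an active block at a level with `2 * L ≤ p + 1 < 4 *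
L`: the first aligned `a` inside the square makes `u[a..n)` have a border of length `q ≥ L` and
period `p = n - a - q`, and the part of the square before `a` is a common suffix of `u[0..a)` and
`u[0..a+p)` (`exists_block_of_square`). Conversely, a border of period `p` and a common suffix of
length `l` with `p ≤ l + q` give a square (`not_squarefreeUpTo_of_leftExt`).

Each active block maintains its Knuth-Morris-Pratt border table, in amortized constant time per
letter, and the left extension for each `p` at which the block recurs. This extension does not
depend on `n`, so it is computed once, in time O(`p`), when the recurrence is completed, that is
when the border of length exactly `L` appears. It may be cut off at `p - L`, since `q ≥ L` then
already gives a square.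

The time bound uses that the text before the newest letter is squarefree. Recurrences of a block are
at distance at least `L` (`border_gap`), so a block pays for O(1) scans of length O(`L`); nested
borders more than halve (`two_mul_border_lt`), so few borders of length at least `L` are examined
per letter. A block costs O(`L`) in its lifetime, a level O(`n`), and there are O(log `n`) levels.
Once a square is found, every later step is constant. Space is linear because each level reuses
eight memory slots of size O(`L`) cyclically, and the level sizes form a geometric series. -/

namespace OnlineSquares

/-! ### Borders, left extensions and squares -/

section Combinatorics

variable {β : Type*} (u : ℕ → β)

/-- The length `n` prefix of the infinite word `u` is squarefree. -/
def SquarefreeUpTo (n : ℕ) : Prop :=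
  ∀ s p, 0 < p → s + 2 * p ≤ n → ¬ ∀ j < p, u (s + j) = u (s + p + j)

/-- The factor of length `i` of `u` at position `a` has a proper border of length `q`. -/
def Border (a i q : ℕ) : Prop :=
  q < i ∧ ∀ j < q, u (a + j) = u (a + (i - q) + j)

open Classical in
/-- The length of the longest proper border of the factor of length `i` at position `a`. -/
noncomputable def maxBorder (a i : ℕ) : ℕ :=
  Nat.findGreatest (Border u a i) (i - 1)

/-- `l` is the length of the longest common suffix of `u[0..a)` and `u[0..a+p)`, except that it
need not be longer than `p - L`. -/
def IsLeftExt (a L p l : ℕ) : Prop :=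
  l ≤ a ∧ l ≤ p ∧ (∀ j < l, u (a - j - 1) = u (a + p - j - 1)) ∧
    (l < a → l + L < p → u (a - l - 1) ≠ u (a + p - l - 1))

variable {u}

theorem SquarefreeUpTo.mono {m n : ℕ} (h : SquarefreeUpTo u n) (hm : m ≤ n) :
    SquarefreeUpTo u m :=
  fun s p hp hs => h s p hp (hs.trans hm)

theorem Border.nested {a i q r : ℕ} (hq : Border u a i q) (hr : Border u a i r) (h : r < q) :
    Border u a q r := by
  refine ⟨h, fun j hj => ?_⟩
  have h1 := hr.2 j hj
  have h2 := hq.2 (q - r + j) (by omega)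
  have := hq.1
  rw [h1, show a + (q - r) + j = a + (q - r + j) by omega, h2]
  congr 1; omega

theorem Border.trans {a i q r : ℕ} (hq : Border u a i q) (hr : Border u a q r) :
    Border u a i r := by
  have h0 := hq.1
  have h0' := hr.1
  refine ⟨by omega, fun j hj => ?_⟩
  have h1 := hr.2 j hj
  have h2 := hq.2 (q - r + j) (by omega)
  rw [h1, show a + (q - r) + j = a + (q - r + j) by omega, h2]
  congr 1; omega

/-- The recursion behind the border table: nonempty borders of the longer factor are the borders of
the shorter one that the new letter extends. -/
theorem border_succ {a i q : ℕ} :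
    Border u a (i + 1) (q + 1) ↔ Border u a i q ∧ u (a + q) = u (a + i) := by
  constructor
  · rintro ⟨h, h'⟩
    refine ⟨⟨by omega, fun j hj => ?_⟩, ?_⟩
    · rw [h' j (by omega)]; congr 1; omega
    · rw [h' q (by omega)]; congr 1; omega
  · rintro ⟨⟨h, h'⟩, h2⟩
    refine ⟨by omega, fun j hj => ?_⟩
    rcases Nat.lt_succ_iff_lt_or_eq.1 hj with hj | rfl
    · rw [h' j hj]; congr 1; omega
    · rw [h2]; congr 1; omega

theorem border_zero {a i : ℕ} (h : 0 < i) : Border u a i 0 :=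
  ⟨h, fun _ hj => absurd hj (by omega)⟩

theorem border_maxBorder {a i : ℕ} (h : 0 < i) : Border u a i (maxBorder u a i) := by
  classical
  exact Nat.findGreatest_spec (P := Border u a i) (Nat.zero_le _) (border_zero h)

theorem Border.le_maxBorder {a i q : ℕ} (h : Border u a i q) : q ≤ maxBorder u a i := by
  classical
  exact Nat.le_findGreatest (by have := h.1; omega) h

theorem maxBorder_lt {a i : ℕ} (h : 0 < i) : maxBorder u a i < i := (border_maxBorder h).1

theorem maxBorder_zero (a : ℕ) : maxBorder u a 0 = 0 := by simp [maxBorder]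

theorem maxBorder_eq {a i q : ℕ} (h : Border u a i q) (h' : ∀ r, Border u a i r → r ≤ q) :
    maxBorder u a i = q :=
  le_antisymm (h' _ (border_maxBorder (by have := h.1; omega))) h.le_maxBorder

theorem maxBorder_succ_le (a i : ℕ) : maxBorder u a (i + 1) ≤ maxBorder u a i + 1 := by
  have h := border_maxBorder (u := u) (a := a) (i := i + 1) (by omega)
  rcases hq : maxBorder u a (i + 1) with _ | q
  · omega
  · rw [hq, border_succ] at h
    have := h.1.le_maxBorder
    omega

/-- A border covering at least half of the factor makes `i - q` a period at most `i / 2`, hence a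
square prefix. -/
theorem SquarefreeUpTo.two_mul_border_lt {a i q : ℕ} (hu : SquarefreeUpTo u (a + i))
    (h : Border u a i q) : 2 * q < i := by
  by_contra hc
  have h1 := h.1
  refine hu a (i - q) (by omega) (by omega) fun j hj => h.2 j (by omega)

/-- Two occurrences of a word of length `L` at distance `d = i' - i < L` overlap and produce a
square of period `d`. It ends at `a + i' - L + d`, strictly before `a + i'`, so squarefreeness
without the last letter suffices. -/
theorem SquarefreeUpTo.border_gap {a i i' L : ℕ} (hu : SquarefreeUpTo u (a + i' - 1))
    (h : Border u a i L) (h' : Border u a i' L) (hi : i < i') : i + L ≤ i' := by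
  by_contra hc
  have h1 := h.1
  refine hu (a + (i - L)) (i' - i) (by omega) (by omega) fun j hj => ?_
  rw [← h.2 j (by omega), h'.2 j (by omega)]
  congr 1; omega

/-- A border together with a long enough left extension gives a square. -/
theorem not_squarefreeUpTo_of_leftExt {a L i q l : ℕ} (hq : Border u a i q)
    (hl : IsLeftExt u a L (i - q) l) (h : i - q ≤ l + q) : ¬ SquarefreeUpTo u (a + i) := by
  intro hu
  obtain ⟨h1, h2, h3, -⟩ := hl
  have h0 := hq.1
  -- The square starts at `a - l`; its end `a - l + 2 * (i - q)` is at most `a + i` exactly because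
  -- `i - q ≤ l + q`.
  refine hu (a - l) (i - q) (by omega) (by omega) fun j hj => ?_
  rcases lt_or_ge j l with hj' | hj'
  · have := h3 (l - j - 1) (by omega)
    convert this using 2 <;> omega
  · have := hq.2 (j - l) (by omega)
    convert this using 2 <;> omega

/-- A square that ends at `n` is found from some aligned block. -/
theorem exists_block_of_square {n s p : ℕ} (hs : 0 < s) (hp : 0 < p) (hn : s + 2 * p = n)
    (h : ∀ j < p, u (s + j) = u (s + p + j)) :
    ∃ k c, 1 ≤ c ∧ c * 2 ^ k < n ∧ n ≤ c * 2 ^ k + 8 * 2 ^ k ∧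
      ∃ q, Border u (c * 2 ^ k) (n - c * 2 ^ k) q ∧ 2 ^ k ≤ q ∧
        ∀ l, IsLeftExt u (c * 2 ^ k) (2 ^ k) (n - c * 2 ^ k - q) l →
          n - c * 2 ^ k - q ≤ l + q := by
  -- The level is chosen with `2 * L ≤ p + 1 < 4 * L`: the upper bound gives `n - a ≤ 2 * p ≤ 8 *
  -- L`, the lower one leaves a border of length at least `L` after rounding `s` up.
  have hlog : 1 ≤ Nat.log 2 (p + 1) := Nat.log_pos (by omega) (by omega)
  obtain ⟨k, hk⟩ : ∃ k, Nat.log 2 (p + 1) = k + 1 := ⟨_, (Nat.sub_add_cancel hlog).symm⟩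
  have h1 : 2 ^ (k + 1) ≤ p + 1 := hk ▸ Nat.pow_log_le_self 2 (by omega)
  have h2 : p + 1 < 2 ^ (k + 1 + 1) := hk ▸ Nat.lt_pow_succ_log_self (by omega) _
  rw [pow_succ] at h1
  rw [pow_succ, pow_succ] at h2
  have hL : 0 < 2 ^ k := by positivity
  -- The block index is `s / L` rounded up, so that `s ≤ a < s + L`.
  refine ⟨k, (s + 2 ^ k - 1) / 2 ^ k, ?_⟩
  generalize 2 ^ k = L at *
  have h3 : (s + L - 1) / L * L ≤ s + L - 1 := Nat.div_mul_le_self _ _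
  have h4 : s + L - 1 < (s + L - 1) / L * L + L := by
    have := Nat.lt_div_mul_add (a := s + L - 1) hL
    omega
  have h0 : 1 ≤ (s + L - 1) / L := (Nat.one_le_div_iff hL).2 (by omega)
  refine ⟨h0, ?_⟩
  generalize (s + L - 1) / L * L = a at *
  refine ⟨by omega, by omega, s + p - a, ⟨by omega, fun j hj => ?_⟩, by omega, ?_⟩
  · have := h (a - s + j) (by omega)
    convert this using 2 <;> omega
  -- An extension shorter than `a - s` would stop at a mismatch, because `l + L < 2 * L - 1 ≤ p`
  -- excludes the cutoff; but the square has no mismatch there.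
  · rintro l ⟨h5, h6, h7, h8⟩
    by_contra hc
    refine h8 (by omega) (by omega) ?_
    have := h (a - s - l - 1) (by omega)
    convert this using 2 <;> omega

end Combinatorics

/-! ### Amortized operation counts -/

section Cost

variable {β : Type*} (u : ℕ → β)

open Classical in
/-- Amortized cost bound for the `i`-th step of the block of length `L` at position `a`. -/
noncomputable def blockCost (a L i : ℕ) : ℕ :=
  100 * (maxBorder u a (i - 1) + 1 - maxBorder u a i) + 2000 +
    if Border u a i L then 1000 * L else 0

/-- The blocks of length `L` that are active when `m` letters have been read. -/
def activeBlocks (L m : ℕ) : Finset ℕ :=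
  Finset.Ico (1 + ((m - 1) / L + 1 - 9)) ((m - 1) / L + 1)

/-- Cost bound for the level of block length `L` in the `m`-th step. -/
noncomputable def levelCost (L m : ℕ) : ℕ :=
  100 + ∑ c ∈ activeBlocks L m, blockCost u (c * L) L (m - c * L)

/-- Cost bound for the `m`-th step. -/
noncomputable def stepCost (m : ℕ) : ℕ :=
  100 + ∑ k ∈ Finset.range (Nat.log 2 m + 1), levelCost u (2 ^ k) m

/-- Bound for the total cost of `n` steps. -/
def totalBound (n : ℕ) : ℕ := n * (30000 * (Nat.log 2 n + 2))

variable {u}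

/-- The lifetime cost of a block: at most `100 * r` for moves between borders, `2000 * r` for fixed
work, and at most nine scans at `1000 * L`, with `r ≤ 8 * L`. -/
theorem sum_blockCost_le {a L r : ℕ} (hL : 0 < L) (hr : r ≤ 8 * L)
    (hu : SquarefreeUpTo u (a + r - 1)) :
    ∑ i ∈ Finset.range r, blockCost u a L (i + 1) ≤ 26000 * L := by
  classical
  -- The potential telescopes in spite of truncated subtraction, since `maxBorder` grows by at most
  -- one per letter.
  have h1 : ∀ r, ∑ i ∈ Finset.range r, (maxBorder u a i + 1 - maxBorder u a (i + 1)) +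
      maxBorder u a r = r := by
    intro r
    induction r with
    | zero => simp [maxBorder_zero]
    | succ r ih =>
      rw [Finset.sum_range_succ]
      have := maxBorder_succ_le (u := u) a r
      omega
  -- Ends of occurrences are at least `L` apart, so they have distinct quotients by `L`.
  have h2 : ((Finset.range r).filter fun i => Border u a (i + 1) L).card ≤ 9 := by
    have : ((Finset.range r).filter fun i => Border u a (i + 1) L).card ≤
        (Finset.range 9).card := by
      refine Finset.card_le_card_of_injOn (fun i => i / L) ?_ ?_
      · intro i hi
        simp only [Finset.coe_filter, Finset.mem_range, Set.mem_ofPred_eq] at hi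
        simp only [Finset.coe_range, Set.mem_Iio]
        rw [Nat.div_lt_iff_lt_mul hL]
        omega
      · have key : ∀ i i', i' < r → Border u a (i + 1) L → Border u a (i' + 1) L →
            i < i' → i / L < i' / L := by
          intro i i' hi' hb hb' hlt
          have := SquarefreeUpTo.border_gap (hu.mono (by omega)) hb hb' (by omega)
          calc i / L < i / L + 1 := by omega
            _ = (i + L) / L := (Nat.add_div_right _ hL).symm
            _ ≤ i' / L := Nat.div_le_div_right (by omega)
        intro i hi i' hi' heq
        simp only [Finset.coe_filter, Finset.mem_range, Set.mem_ofPred_eq] at hi hi' heq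
        rcases lt_trichotomy i i' with h | h | h
        · exact absurd heq (key i i' hi'.1 hi.2 hi'.2 h).ne
        · exact h
        · exact absurd heq (key i' i hi.1 hi'.2 hi.2 h).ne'
    simpa using this
  simp only [blockCost, Finset.sum_add_distrib, Nat.add_sub_cancel, ← Finset.mul_sum,
    ← Finset.sum_filter, Finset.sum_const, smul_eq_mul, Finset.card_range]
  have h3 := h1 r
  have h4 := Nat.mul_le_mul_right L h2
  omega

/-- Exchanging the sums over letters and blocks turns the per-step bound into the lifetime bound of
at most `(n - 1) / L` blocks. -/
theorem sum_levelCost_le {n L : ℕ} (hL : 0 < L) (hu : SquarefreeUpTo u (n - 1)) :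
    ∑ m ∈ Finset.range n, levelCost u L (m + 1) ≤ 26100 * n := by
  have h1 : ∑ m ∈ Finset.range n, ∑ c ∈ activeBlocks L (m + 1),
      blockCost u (c * L) L (m + 1 - c * L) =
      ∑ c ∈ Finset.Ico 1 ((n - 1) / L + 1), ∑ m ∈ Finset.Ico (c * L) (min n (c * L + 8 * L)),
        blockCost u (c * L) L (m + 1 - c * L) := by
    refine Finset.sum_comm' fun m c => ?_
    simp only [activeBlocks, Finset.mem_range, Finset.mem_Ico, Nat.add_sub_cancel, lt_min_iff]
    have e1 : c < m / L + 1 ↔ c * L ≤ m := by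
      rw [Nat.lt_succ_iff, Nat.le_div_iff_mul_le hL]
    -- Truncation makes the left end `max 1 (m / L - 7)`, leaving only the last eight block indices.
    have e2 : 1 + (m / L + 1 - 9) ≤ c ↔ 1 ≤ c ∧ m < c * L + 8 * L := by
      rw [← add_mul, ← Nat.div_lt_iff_lt_mul hL]; omega
    have e3 : c < (n - 1) / L + 1 ↔ c * L ≤ n - 1 := by
      rw [Nat.lt_succ_iff, Nat.le_div_iff_mul_le hL]
    rw [e1, e2, e3]
    omega
  have h2 : ∀ c ∈ Finset.Ico 1 ((n - 1) / L + 1),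
      ∑ m ∈ Finset.Ico (c * L) (min n (c * L + 8 * L)),
        blockCost u (c * L) L (m + 1 - c * L) ≤ 26000 * L := by
    intro c hc
    rw [Finset.sum_Ico_eq_sum_range]
    refine le_trans (le_of_eq ?_) (sum_blockCost_le (u := u) (a := c * L)
      (r := min n (c * L + 8 * L) - c * L) hL (by omega) (hu.mono ?_))
    · refine Finset.sum_congr rfl fun i _ => ?_
      congr 1; omega
    · have : c * L ≤ n - 1 := by
        rw [Finset.mem_Ico, Nat.lt_succ_iff, Nat.le_div_iff_mul_le hL] at hc
        exact hc.2
      omega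
  have h3 := Finset.sum_le_sum h2
  simp only [Finset.sum_const, Nat.card_Ico, smul_eq_mul, Nat.add_sub_cancel] at h3
  have h4 : (n - 1) / L * (26000 * L) ≤ 26000 * n := by
    have := Nat.div_mul_le_self (n - 1) L
    calc (n - 1) / L * (26000 * L) = 26000 * ((n - 1) / L * L) := by ring
      _ ≤ 26000 * n := by omega
  simp only [levelCost, Finset.sum_add_distrib, Finset.sum_const, Finset.card_range, smul_eq_mul]
  rw [h1]
  omega

theorem sum_stepCost_le {n : ℕ} (hu : SquarefreeUpTo u (n - 1)) :
    ∑ m ∈ Finset.range n, stepCost u (m + 1) + 100 * n ≤ totalBound n := by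
  have h1 : ∑ m ∈ Finset.range n, ∑ k ∈ Finset.range (Nat.log 2 (m + 1) + 1),
      levelCost u (2 ^ k) (m + 1) ≤
      ∑ k ∈ Finset.range (Nat.log 2 n + 1), ∑ m ∈ Finset.range n,
        levelCost u (2 ^ k) (m + 1) := by
    rw [Finset.sum_comm]
    refine Finset.sum_le_sum fun m hm => Finset.sum_le_sum_of_subset ?_
    rw [Finset.mem_range] at hm
    refine Finset.range_subset_range.2 (Nat.succ_le_succ (Nat.log_mono_right (by omega)))
  rcases Nat.eq_zero_or_pos n with rfl | hn
  · simp
  have h2 : ∀ k ∈ Finset.range (Nat.log 2 n + 1),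
      ∑ m ∈ Finset.range n, levelCost u (2 ^ k) (m + 1) ≤ 26100 * n := by
    intro k _
    exact sum_levelCost_le (by positivity) hu
  have h3 := Finset.sum_le_sum h2
  simp only [Finset.sum_const, Finset.card_range, smul_eq_mul] at h3
  simp only [stepCost, Finset.sum_add_distrib, Finset.sum_const, Finset.card_range, smul_eq_mul,
    totalBound]
  have h4 : (Nat.log 2 n + 1) * (26100 * n) + 30000 * n ≤ n * (30000 * (Nat.log 2 n + 2)) := by
    nlinarith [Nat.zero_le (Nat.log 2 n * n)]
  omega

theorem totalBound_succ (n : ℕ) : totalBound n + 100 ≤ totalBound (n + 1) := by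
  have h := Nat.log_mono_right (b := 2) (Nat.le_succ n)
  simp only [totalBound, Nat.succ_eq_add_one] at *
  have := Nat.mul_le_mul_left n (Nat.mul_le_mul_left 30000 (Nat.add_le_add_right h 2))
  nlinarith

end Cost

/-! ### Weakest preconditions -/

section Wp

variable {α : Type*} {M W : ℕ}

/-- The command `c` terminates from `s` within the limits, with a result and a cost for which `Q`
holds. -/
def Wp (M W : ℕ) (c : Cmd) (s : State α) (Q : State α → ℕ → Prop) : Prop :=
  ∃ s' t, Exec M W c s s' t ∧ Q s' t

theorem Wp.mono {c : Cmd} {s : State α} {Q Q' : State α → ℕ → Prop} (h : Wp M W c s Q)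
    (hQ : ∀ s' t, Q s' t → Q' s' t) : Wp M W c s Q' :=
  let ⟨s', t, he, hq⟩ := h
  ⟨s', t, he, hQ _ _ hq⟩

theorem Wp.skip {s : State α} {Q : State α → ℕ → Prop} (h : Q s 1) : Wp M W .skip s Q :=
  ⟨_, _, .skip s, h⟩

theorem Wp.assign {s : State α} {Q : State α → ℕ → Prop} {x : ℕ} {e : Expr}
    (he : e.Within M W s) (h : Q (s.setVar x (e.eval s)) (e.cost + 1)) :
    Wp M W (.assign x e) s Q :=
  ⟨_, _, .assign s x e he, h⟩

theorem Wp.store {s : State α} {Q : State α → ℕ → Prop} {A : ℕ} {i e : Expr}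
    (hi : i.Within M W s ∧ i.eval s < M ∧ e.Within M W s)
    (h : Q (s.setArr A (i.eval s) (e.eval s)) (i.cost + e.cost + 1)) :
    Wp M W (.store A i e) s Q :=
  ⟨_, _, .store s A i e hi.1 hi.2.1 hi.2.2, h⟩

theorem Wp.lstore {s : State α} {Q : State α → ℕ → Prop} {L : ℕ} {i : Expr} {l : LExpr}
    (hi : i.Within M W s ∧ i.eval s < M ∧ l.Within M W s)
    (h : Q (s.setLArr L (i.eval s) (l.eval s)) (i.cost + l.cost + 1)) :
    Wp M W (.lstore L i l) s Q :=
  ⟨_, _, .lstore s L i l hi.1 hi.2.1 hi.2.2, h⟩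

theorem Wp.seq {c d : Cmd} {s : State α} {Q : State α → ℕ → Prop}
    (h : Wp M W c s fun s' t => Wp M W d s' fun s'' t' => Q s'' (t + t')) :
    Wp M W (.seq c d) s Q :=
  let ⟨_, _, he, _, _, he', hq⟩ := h
  ⟨_, _, .seq he he', hq⟩

theorem Wp.ite {b : Test} {c d : Cmd} {s : State α} {Q : State α → ℕ → Prop}
    (hb : b.Within M W s)
    (h₁ : b.Holds s → Wp M W c s fun s' t => Q s' (b.cost + t + 1))
    (h₂ : ¬ b.Holds s → Wp M W d s fun s' t => Q s' (b.cost + t + 1)) :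
    Wp M W (.ite b c d) s Q := by
  by_cases h : b.Holds s
  · obtain ⟨_, _, he, hq⟩ := h₁ h
    exact ⟨_, _, .ite_true hb h he, hq⟩
  · obtain ⟨_, _, he, hq⟩ := h₂ h
    exact ⟨_, _, .ite_false hb h he, hq⟩

/-- A single unfolding of the loop; termination is supplied at each use by strong induction on a
variant. -/
theorem Wp.while {b : Test} {c : Cmd} {s : State α} {Q : State α → ℕ → Prop}
    (hb : b.Within M W s)
    (h₁ : b.Holds s → Wp M W c s fun s' t =>
      Wp M W (.while b c) s' fun s'' t' => Q s'' (b.cost + t + 1 + t'))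
    (h₂ : ¬ b.Holds s → Q s (b.cost + 1)) :
    Wp M W (.while b c) s Q := by
  by_cases h : b.Holds s
  · obtain ⟨_, _, he, _, _, he', hq⟩ := h₁ h
    exact ⟨_, _, .while_true hb h he he', hq⟩
  · exact ⟨_, _, .while_false hb h, h₂ h⟩

end Wp

/-! ### The memory of the algorithm -/

/-- The memory cells used by the algorithm. -/
structure Mem (α : Type*) where
  ans : ℕ
  n : ℕ
  L : ℕ
  c : ℕ
  lim : ℕ
  a : ℕ
  i : ℕ
  b : ℕ
  q : ℕ
  p : ℕ
  l : ℕ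
  F : ℕ → ℕ
  E : ℕ → ℕ
  inp : Option α
  T : ℕ → Option α

namespace Mem

variable {α : Type*} (m : Mem α)

/-- The memory as a state of the machine. -/
def st : State α where
  var
    | 0 => m.ans | 1 => m.n | 2 => m.L | 3 => m.c | 4 => m.lim | 5 => m.a | 6 => m.i
    | 7 => m.b | 8 => m.q | 9 => m.p | 10 => m.l | _ => 0
  arr
    | 0 => m.F | 1 => m.E | _ => fun _ => 0
  lvar
    | 0 => m.inp | _ => none
  larr
    | 0 => m.T | _ => fun _ => none

/-- The initial memory. -/
def blank (α : Type*) : Mem α :=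
  ⟨0, 0, 0, 0, 0, 0, 0, 0, 0, 0, 0, fun _ => 0, fun _ => 0, none, fun _ => none⟩

theorem st_blank : (blank α).st = State.blank α := by
  simp only [st, State.blank, State.mk.injEq]
  refine ⟨?_, ?_, ?_, ?_⟩ <;> funext x
  · rcases x with _ | _ | _ | _ | _ | _ | _ | _ | _ | _ | _ | x <;> rfl
  · rcases x with _ | _ | x <;> rfl
  · rcases x with _ | x <;> rfl
  · rcases x with _ | x <;> rfl

@[simp] theorem st_var_0 : m.st.var 0 = m.ans := rfl
@[simp] theorem st_var_1 : m.st.var 1 = m.n := rfl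
@[simp] theorem st_var_2 : m.st.var 2 = m.L := rfl
@[simp] theorem st_var_3 : m.st.var 3 = m.c := rfl
@[simp] theorem st_var_4 : m.st.var 4 = m.lim := rfl
@[simp] theorem st_var_5 : m.st.var 5 = m.a := rfl
@[simp] theorem st_var_6 : m.st.var 6 = m.i := rfl
@[simp] theorem st_var_7 : m.st.var 7 = m.b := rfl
@[simp] theorem st_var_8 : m.st.var 8 = m.q := rfl
@[simp] theorem st_var_9 : m.st.var 9 = m.p := rfl
@[simp] theorem st_var_10 : m.st.var 10 = m.l := rfl
@[simp] theorem st_arr_0 : m.st.arr 0 = m.F := rfl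
@[simp] theorem st_arr_1 : m.st.arr 1 = m.E := rfl
@[simp] theorem st_lvar_0 : m.st.lvar 0 = m.inp := rfl
@[simp] theorem st_larr_0 : m.st.larr 0 = m.T := rfl

variable {m}

theorem update_eq {β : Type*} {f g : ℕ → β} {k : ℕ} {v : β} (h : g k = v)
    (h' : ∀ x, x ≠ k → f x = g x) : Function.update f k v = g := by
  funext x
  by_cases hx : x = k
  · subst hx; simp [h]
  · simp [hx, h' x hx]

variable (m) (v x : ℕ)

/-- Serves the rewriting rules that bring every state met in symbolic execution back to the form
`m.st`. -/
theorem setVar_eq {m m' : Mem α} {k v : ℕ} (h : m'.st.var k = v)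
    (h' : ∀ x, x ≠ k → m.st.var x = m'.st.var x) (hF : m.F = m'.F) (hE : m.E = m'.E)
    (hi : m.inp = m'.inp) (hT : m.T = m'.T) : m.st.setVar k v = m'.st := by
  simp only [State.setVar, update_eq h h']
  simp only [st, hF, hE, hi, hT]

@[simp] theorem setVar_0 : m.st.setVar 0 v = { m with ans := v }.st := by
  refine setVar_eq rfl (fun x hx => ?_) rfl rfl rfl rfl
  rcases x with _ | _ | _ | _ | _ | _ | _ | _ | _ | _ | _ | x <;>
    first | rfl | exact absurd rfl hx

@[simp] theorem setVar_1 : m.st.setVar 1 v = { m with n := v }.st := by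
  refine setVar_eq rfl (fun x hx => ?_) rfl rfl rfl rfl
  rcases x with _ | _ | _ | _ | _ | _ | _ | _ | _ | _ | _ | x <;>
    first | rfl | exact absurd rfl hx

@[simp] theorem setVar_2 : m.st.setVar 2 v = { m with L := v }.st := by
  refine setVar_eq rfl (fun x hx => ?_) rfl rfl rfl rfl
  rcases x with _ | _ | _ | _ | _ | _ | _ | _ | _ | _ | _ | x <;>
    first | rfl | exact absurd rfl hx

@[simp] theorem setVar_3 : m.st.setVar 3 v = { m with c := v }.st := by
  refine setVar_eq rfl (fun x hx => ?_) rfl rfl rfl rfl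
  rcases x with _ | _ | _ | _ | _ | _ | _ | _ | _ | _ | _ | x <;>
    first | rfl | exact absurd rfl hx

@[simp] theorem setVar_4 : m.st.setVar 4 v = { m with lim := v }.st := by
  refine setVar_eq rfl (fun x hx => ?_) rfl rfl rfl rfl
  rcases x with _ | _ | _ | _ | _ | _ | _ | _ | _ | _ | _ | x <;>
    first | rfl | exact absurd rfl hx

@[simp] theorem setVar_5 : m.st.setVar 5 v = { m with a := v }.st := by
  refine setVar_eq rfl (fun x hx => ?_) rfl rfl rfl rfl
  rcases x with _ | _ | _ | _ | _ | _ | _ | _ | _ | _ | _ | x <;>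
    first | rfl | exact absurd rfl hx

@[simp] theorem setVar_6 : m.st.setVar 6 v = { m with i := v }.st := by
  refine setVar_eq rfl (fun x hx => ?_) rfl rfl rfl rfl
  rcases x with _ | _ | _ | _ | _ | _ | _ | _ | _ | _ | _ | x <;>
    first | rfl | exact absurd rfl hx

@[simp] theorem setVar_7 : m.st.setVar 7 v = { m with b := v }.st := by
  refine setVar_eq rfl (fun x hx => ?_) rfl rfl rfl rfl
  rcases x with _ | _ | _ | _ | _ | _ | _ | _ | _ | _ | _ | x <;>
    first | rfl | exact absurd rfl hx

@[simp] theorem setVar_8 : m.st.setVar 8 v = { m with q := v }.st := by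
  refine setVar_eq rfl (fun x hx => ?_) rfl rfl rfl rfl
  rcases x with _ | _ | _ | _ | _ | _ | _ | _ | _ | _ | _ | x <;>
    first | rfl | exact absurd rfl hx

@[simp] theorem setVar_9 : m.st.setVar 9 v = { m with p := v }.st := by
  refine setVar_eq rfl (fun x hx => ?_) rfl rfl rfl rfl
  rcases x with _ | _ | _ | _ | _ | _ | _ | _ | _ | _ | _ | x <;>
    first | rfl | exact absurd rfl hx

@[simp] theorem setVar_10 : m.st.setVar 10 v = { m with l := v }.st := by
  refine setVar_eq rfl (fun x hx => ?_) rfl rfl rfl rfl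
  rcases x with _ | _ | _ | _ | _ | _ | _ | _ | _ | _ | _ | x <;>
    first | rfl | exact absurd rfl hx

@[simp] theorem setArr_0 :
    m.st.setArr 0 x v = { m with F := Function.update m.F x v }.st := by
  simp only [State.setArr, st, State.mk.injEq, true_and, and_true]
  refine update_eq rfl fun y hy => ?_
  rcases y with _ | _ | y <;> first | rfl | exact absurd rfl hy

@[simp] theorem setArr_1 :
    m.st.setArr 1 x v = { m with E := Function.update m.E x v }.st := by
  simp only [State.setArr, st, State.mk.injEq, true_and, and_true]
  refine update_eq rfl fun y hy => ?_
  rcases y with _ | _ | y <;> first | rfl | exact absurd rfl hy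

@[simp] theorem setLVar_0 (o : Option α) : m.st.setLVar 0 o = { m with inp := o }.st := by
  simp only [State.setLVar, st, State.mk.injEq, true_and, and_true]
  refine update_eq rfl fun y hy => ?_
  rcases y with _ | y <;> first | rfl | exact absurd rfl hy

@[simp] theorem setLArr_0 (o : Option α) :
    m.st.setLArr 0 x o = { m with T := Function.update m.T x o }.st := by
  simp only [State.setLArr, st, State.mk.injEq, true_and]
  refine update_eq rfl fun y hy => ?_
  rcases y with _ | y <;> first | rfl | exact absurd rfl hy

end Mem

/-! ### The program -/

/-- Move to the longest border that can be extended by the new letter, or to the empty border. -/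
def fallback : Cmd :=
  .while (.and (.lt (.lit 0) (.var 8))
      (.not (.leq (.get 0 (.bin .add (.var 5) (.var 8))) (.get 0 (.bin .sub (.var 1) (.lit 1))))))
    (.assign 8 (.get 0 (.bin .add (.var 7) (.var 8))))

/-- Compute the longest border of the active part of the current block. -/
def updateBorder : Cmd :=
  .seq (.assign 8 (.lit 0))
    (.seq
      (.ite (.lt (.lit 1) (.var 6))
        (.seq (.assign 8 (.get 0 (.bin .add (.var 7) (.bin .sub (.var 6) (.lit 1)))))
          (.seq fallback
            (.ite (.leq (.get 0 (.bin .add (.var 5) (.var 8)))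
                (.get 0 (.bin .sub (.var 1) (.lit 1))))
              (.assign 8 (.bin .add (.var 8) (.lit 1))) .skip)))
        .skip)
      (.store 0 (.bin .add (.var 7) (.var 6)) (.var 8)))

/-- Extend an occurrence of the block to the left. -/
def scanLeft : Cmd :=
  .while (.and (.lt (.var 10) (.var 5)) (.and (.lt (.bin .add (.var 10) (.var 2)) (.var 9))
      (.leq (.get 0 (.bin .sub (.bin .sub (.var 5) (.var 10)) (.lit 1)))
        (.get 0 (.bin .sub (.bin .sub (.bin .add (.var 5) (.var 9)) (.var 10)) (.lit 1))))))
    (.assign 10 (.bin .add (.var 10) (.lit 1)))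

/-- Compute and store the left extension if the current border is the block itself. -/
def recordLeft : Cmd :=
  .ite (.eq (.var 8) (.var 2))
    (.seq (.assign 10 (.lit 0))
      (.seq scanLeft (.store 1 (.bin .add (.var 7) (.var 9)) (.var 10))))
    .skip

/-- Check one border for a square. -/
def checkBorder : Cmd :=
  .seq (.assign 9 (.bin .sub (.var 6) (.var 8)))
    (.seq recordLeft
      (.seq
        (.ite (.lt (.bin .add (.get 1 (.bin .add (.var 7) (.var 9))) (.var 8)) (.var 9)) .skip
          (.assign 0 (.lit 0)))
        (.assign 8 (.get 0 (.bin .add (.var 7) (.var 8))))))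

/-- Check all borders of the active part that are at least as long as the block. -/
def checkBorders : Cmd := .while (.not (.lt (.var 8) (.var 2))) checkBorder

/-- Compute the position, the length of the active part and the memory region of a block. -/
def setBlock : Cmd :=
  .seq (.assign 5 (.bin .mul (.var 3) (.var 2)))
    (.seq (.assign 6 (.bin .sub (.var 1) (.var 5)))
      (.assign 7 (.bin .mul (.bin .add (.bin .mod (.var 3) (.lit 8)) (.lit 8))
        (.bin .mul (.lit 16) (.var 2)))))

/-- The work on one block in one step. -/
def processBlock : Cmd := .seq setBlock (.seq updateBorder checkBorders)

/-- The work on the active blocks of one level, from right to left. -/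
def blockLoop : Cmd :=
  .while (.lt (.var 4) (.var 3)) (.seq (.assign 3 (.bin .sub (.var 3) (.lit 1))) processBlock)

/-- The work on one level in one step. -/
def processLevel : Cmd :=
  .seq (.assign 3 (.bin .add (.bin .div (.bin .sub (.var 1) (.lit 1)) (.var 2)) (.lit 1)))
    (.seq (.assign 4 (.bin .add (.lit 1) (.bin .sub (.var 3) (.lit 9))))
      (.seq blockLoop (.assign 2 (.bin .mul (.lit 2) (.var 2)))))

def levelLoop : Cmd := .while (.not (.lt (.var 1) (.var 2))) processLevel

/-- The online square detection algorithm. -/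
def squareDetector : OnlineAlgorithm where
  start := .seq (.assign 0 (.lit 1)) (.assign 1 (.lit 1))
  step :=
    .ite (.eq (.var 0) (.lit 0)) .skip
      (.seq (.lstore 0 (.var 1) (.var 0))
        (.seq (.assign 1 (.bin .add (.var 1) (.lit 1)))
          (.seq (.assign 2 (.lit 1)) levelLoop)))
  input := 0
  answer := 0

/-! ### The work on one block -/

attribute [local simp] Expr.eval LExpr.eval BinOp.eval Test.Holds Expr.cost LExpr.cost Test.cost
  Expr.Within LExpr.Within Test.Within

variable {α : Type*} {M W : ℕ}

/-- All numbers in the memory are small. -/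
structure Mem.Small (m : Mem α) (M W : ℕ) : Prop where
  size : 300 * (m.n + 1) ≤ M
  word : 300 * (m.n + 1) ≤ W
  ans : m.ans ≤ 1
  L : m.L ≤ 2 * m.n
  c : m.c ≤ m.n
  lim : m.lim ≤ m.n
  a : m.a ≤ m.n
  i : m.i ≤ m.n
  b : m.b ≤ 240 * m.n
  q : m.q ≤ m.n
  p : m.p ≤ m.n
  l : m.l ≤ m.n
  F : ∀ x, m.F x ≤ m.n
  E : ∀ x, m.E x ≤ m.n

/-- The loop invariant is that no border extendable by the new letter is longer than `q`. Each
iteration decreases `q`, which pays for it in the amortized bound. -/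
theorem wp_fallback {u : ℕ → Option α} {m : Mem α} (hok : m.Small M W)
    (hT : ∀ x < m.n, m.T x = u x) (hn : m.a + m.i = m.n) (hi : 1 < m.i)
    (hF : ∀ j, 1 ≤ j → j < m.i → m.F (m.b + j) = maxBorder u m.a j)
    (hq : Border u m.a (m.i - 1) m.q)
    (hmax : ∀ r, Border u m.a (m.i - 1) r → u (m.a + r) = u (m.n - 1) → r ≤ m.q) :
    Wp M W fallback m.st fun s' t => ∃ q, s' = { m with q := q }.st ∧
      Border u m.a (m.i - 1) q ∧
      (∀ r, Border u m.a (m.i - 1) r → u (m.a + r) = u (m.n - 1) → r ≤ q) ∧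
      (0 < q → u (m.a + q) = u (m.n - 1)) ∧ t + 100 * q ≤ 100 * m.q + 100 := by
  induction hk : m.q using Nat.strong_induction_on generalizing m with
  | _ k ih =>
  have hq0 := hq.1
  have := hok.size
  have := hok.word
  have := hok.b
  have hF0 := hok.F (m.b + m.q)
  have e1 := hT (m.a + m.q) (by omega)
  have e2 := hT (m.n - 1) (by omega)
  refine Wp.while (by simp; omega) (fun h => ?_) (fun h => ?_)
  · simp [e1, e2] at h
    have hF1 := hF m.q (by omega) (by omega)
    have hlt := maxBorder_lt (u := u) (a := m.a) h.1
    refine Wp.assign (by simp; omega) ?_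
    simp only [Mem.setVar_8]
    refine (@ih (m.F (m.b + m.q)) (by omega) { m with q := m.F (m.b + m.q) }
      { hok with q := hF0 } hT hn hi hF ?_ ?_ rfl).mono ?_
    · simp only [hF1]
      exact hq.trans (border_maxBorder h.1)
    · intro r hr hr'
      simp only [hF1] at *
      -- A shorter border is nested in `q`, hence at most its longest border; `q` itself is excluded
      -- by the mismatch.
      rcases (hmax r hr hr').lt_or_eq with h' | rfl
      · exact (hq.nested hr h').le_maxBorder
      · exact absurd hr' h.2
    · rintro s' t ⟨q, hs, h1, h2, h3, h4⟩
      refine ⟨q, hs, h1, h2, h3, ?_⟩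
      simp at h4 ⊢
      omega
  · simp [e1, e2] at h
    exact ⟨m.q, rfl, hq, hmax, fun h0 => h (by omega), by simp; omega⟩

theorem wp_updateBorder {u : ℕ → Option α} {m : Mem α} (hok : m.Small M W)
    (hT : ∀ x < m.n, m.T x = u x) (hn : m.a + m.i = m.n) (hi : 0 < m.i)
    (hF : ∀ j, 1 ≤ j → j < m.i → m.F (m.b + j) = maxBorder u m.a j) :
    Wp M W updateBorder m.st fun s' t =>
      s' = { m with
        q := maxBorder u m.a m.i
        F := Function.update m.F (m.b + m.i) (maxBorder u m.a m.i) }.st ∧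
      t ≤ 100 * (maxBorder u m.a (m.i - 1) + 1 - maxBorder u m.a m.i) + 300 := by
  have := hok.size
  have := hok.word
  have := hok.b
  have := hok.i
  have := maxBorder_lt (u := u) (a := m.a) hi
  refine Wp.seq (Wp.assign (by simp; omega) (Wp.seq ?_))
  simp only [Mem.setVar_8, Expr.eval]
  have key : Wp M W (.ite (.lt (.lit 1) (.var 6))
        (.seq (.assign 8 (.get 0 (.bin .add (.var 7) (.bin .sub (.var 6) (.lit 1)))))
          (.seq fallback
            (.ite (.leq (.get 0 (.bin .add (.var 5) (.var 8)))
                (.get 0 (.bin .sub (.var 1) (.lit 1))))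
              (.assign 8 (.bin .add (.var 8) (.lit 1))) .skip)))
        .skip) { m with q := 0 }.st fun s' t => s' = { m with q := maxBorder u m.a m.i }.st ∧
      t ≤ 100 * (maxBorder u m.a (m.i - 1) + 1 - maxBorder u m.a m.i) + 200 := by
    refine Wp.ite (by simp; omega) (fun h => ?_) (fun h => ?_)
    · simp at h
      have hF0 := hok.F (m.b + (m.i - 1))
      have hF1 := hF (m.i - 1) (by omega) (by omega)
      refine Wp.seq (Wp.assign (by simp; omega) (Wp.seq ?_))
      simp only [Mem.setVar_8]
      refine (wp_fallback (u := u) (m := { m with q := m.F (m.b + (m.i - 1)) })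
        { hok with q := hF0 } hT hn h hF ?_ ?_).mono ?_
      · simp only [hF1]
        exact border_maxBorder (by omega)
      · intro r hr _
        simp only [hF1]
        exact hr.le_maxBorder
      rintro s' t ⟨q, rfl, h1, h2, h3, h4⟩
      have := h1.1
      simp only at this h1 h2 h3 h4
      have e1 := hT (m.a + q) (by omega)
      have e2 := hT (m.n - 1) (by omega)
      have e3 : m.i - 1 + 1 = m.i := by omega
      have e4 : m.a + (m.i - 1) = m.n - 1 := by omega
      -- The loop leaves `q = 0` untested. If any nonempty border of the longer factor exists, then
      -- `q` is extendable: for `q = 0` that border must have length 1.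
      have hle : ∀ r, Border u m.a m.i (r + 1) → r ≤ q ∧ u (m.a + q) = u (m.n - 1) := by
        intro r hr
        rw [← e3, border_succ, e4] at hr
        have hrq := h2 r hr.1 hr.2
        refine ⟨hrq, ?_⟩
        rcases Nat.eq_zero_or_pos q with rfl | h0
        · rw [← hr.2]; congr 2; omega
        · exact h3 h0
      refine Wp.ite (by simp; omega) (fun h => Wp.assign (by simp; omega) ?_)
        (fun h => Wp.skip ?_)
      · simp [e1, e2] at h
        have : maxBorder u m.a m.i = q + 1 := by
          refine maxBorder_eq ?_ ?_
          · rw [← e3, border_succ, e4]; exact ⟨h1, h⟩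
          · rintro (_ | r) hr
            · omega
            · have := (hle r hr).1; omega
        rw [this]
        refine ⟨by simp, ?_⟩
        simp [hF1] at h4 ⊢
        omega
      · simp [e1, e2] at h
        have hq : q = 0 := by
          by_contra h0
          exact h (h3 (by omega))
        have : maxBorder u m.a m.i = 0 := by
          refine maxBorder_eq (border_zero hi) ?_
          rintro (_ | r) hr
          · omega
          · exact absurd (hle r hr).2 h
        rw [this, hq]
        refine ⟨by simp, ?_⟩
        simp [hF1] at h4 ⊢
        omega
    · simp at h
      have h0 : maxBorder u m.a m.i = 0 := by omega
      refine Wp.skip ⟨by simp [h0], ?_⟩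
      simp
  refine key.mono ?_
  rintro s' t ⟨rfl, ht⟩
  refine Wp.store (by simp; omega) ⟨by simp, ?_⟩
  simp at ht ⊢
  omega

/-- The stopping condition is the maximality clause of `IsLeftExt`, and the bound `l ≤ p` limits the
scan to `p` iterations. -/
theorem wp_scanLeft {u : ℕ → Option α} {m : Mem α} (hok : m.Small M W)
    (hT : ∀ x < m.n, m.T x = u x) (hp : m.a + m.p ≤ m.n)
    (h1 : m.l ≤ m.a) (h2 : m.l ≤ m.p)
    (h3 : ∀ j < m.l, u (m.a - j - 1) = u (m.a + m.p - j - 1)) :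
    Wp M W scanLeft m.st fun s' t => ∃ l, s' = { m with l := l }.st ∧
      IsLeftExt u m.a m.L m.p l ∧ t ≤ 100 * (m.p - m.l) + 100 := by
  induction hk : m.p - m.l using Nat.strong_induction_on generalizing m with
  | _ k ih =>
  have := hok.size
  have := hok.word
  have := hok.L
  have := hok.p
  refine Wp.while (by simp; omega) (fun h => ?_) (fun h => ?_)
  · simp at h
    obtain ⟨h4, h5, h6⟩ := h
    rw [hT _ (by omega), hT _ (by omega)] at h6
    refine Wp.assign (by simp; omega) ?_
    simp only [Mem.setVar_10]
    refine (@ih (m.p - (m.l + 1)) (by omega) { m with l := m.l + 1 }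
      { hok with l := by show m.l + 1 ≤ m.n; omega } hT hp h4
      (by show m.l + 1 ≤ m.p; omega) ?_ rfl).mono ?_
    · intro j hj
      simp only at hj
      rcases Nat.lt_succ_iff_lt_or_eq.1 hj with hj | rfl
      · exact h3 j hj
      · exact h6
    · rintro s' t ⟨l, hs, h7, h8⟩
      refine ⟨l, hs, h7, ?_⟩
      simp at h8 ⊢
      omega
  · refine ⟨m.l, rfl, ⟨h1, h2, h3, fun h4 h5 => ?_⟩, by simp⟩
    simp [h4, h5] at h
    rwa [hT _ (by omega), hT _ (by omega)] at h

theorem wp_recordLeft {u : ℕ → Option α} {m : Mem α} (hok : m.Small M W)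
    (hT : ∀ x < m.n, m.T x = u x) (hp : m.a + m.p ≤ m.n) :
    Wp M W recordLeft m.st fun s' t => ∃ l E, s' = { m with l := l, E := E }.st ∧
      l ≤ m.n ∧ (∀ x, E x ≤ m.n) ∧ (∀ x, x ≠ m.b + m.p → E x = m.E x) ∧
      (m.q ≠ m.L → E = m.E ∧ t ≤ 10) ∧
      (m.q = m.L → IsLeftExt u m.a m.L m.p (E (m.b + m.p)) ∧ t ≤ 100 * m.p + 200) := by
  have := hok.size
  have := hok.word
  have := hok.L
  have := hok.b
  have := hok.q
  refine Wp.ite (by simp; omega) (fun h => ?_) (fun h => ?_)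
  · simp at h
    refine Wp.seq (Wp.assign (by simp; omega) (Wp.seq ?_))
    simp only [Mem.setVar_10, Expr.eval]
    refine (wp_scanLeft (u := u) (m := { m with l := 0 }) { hok with l := Nat.zero_le _ } hT hp
      (Nat.zero_le _) (Nat.zero_le _) (fun j hj => absurd hj (by simp))).mono ?_
    rintro s' t ⟨l, rfl, h1, h2⟩
    have := h1.2.1
    simp only at this
    refine Wp.store (by simp; omega) ⟨l, _, by simp; rfl, by omega, fun x => ?_, fun x hx => ?_,
      fun h' => absurd h h', fun _ => ?_⟩
    · by_cases hx : x = m.b + m.p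
      · subst hx; simp; omega
      · simpa [hx] using hok.E x
    · simp [hx]
    · simp at h2 ⊢
      exact ⟨h1, by omega⟩
  · simp at h
    exact Wp.skip ⟨m.l, m.E, rfl, hok.l, hok.E, fun _ _ => rfl, fun _ => ⟨rfl, by simp⟩,
      fun h' => absurd h' h⟩

/-- The values that the memory has to contain for the block of length `L` at position `a` when
`r` letters from its start on have been read; `b` is its memory region. -/
structure BlockInv (u : ℕ → Option α) (a L b r : ℕ) (F E : ℕ → ℕ) : Prop where
  border : ∀ j, 1 ≤ j → j ≤ r → F (b + j) = maxBorder u a j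
  left : ∀ p, 1 ≤ p → p + L ≤ r → Border u a (p + L) L → IsLeftExt u a L p (E (b + p))

-- The loop descends the chain of borders of length at least `L`. Each step lowers `q / L`, and only
-- the border of length exactly `L` triggers a scan, which the conditional term pays for.
open Classical in
theorem wp_checkBorders {u : ℕ → Option α} {m : Mem α} (hok : m.Small M W)
    (hu : SquarefreeUpTo u (m.n - 1))
    (hT : ∀ x < m.n, m.T x = u x) (hn : m.a + m.i = m.n) (hL : 0 < m.L) (hi : 0 < m.i)
    (hi8 : m.i ≤ 8 * m.L)
    (hF : ∀ j, 1 ≤ j → j ≤ m.i → m.F (m.b + j) = maxBorder u m.a j)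
    (hE : ∀ p, 1 ≤ p → p + m.L < m.i ∨ p + m.L = m.i ∧ m.q < m.L →
      Border u m.a (p + m.L) m.L → IsLeftExt u m.a m.L p (m.E (m.b + p)))
    (hq : Border u m.a m.i m.q) :
    Wp M W checkBorders m.st fun s' t => ∃ ans q p l E,
      s' = { m with ans := ans, q := q, p := p, l := l, E := E }.st ∧
      ({ m with ans := ans, q := q, p := p, l := l, E := E } : Mem α).Small M W ∧
      (∀ x, (∀ j ≤ m.i, x ≠ m.b + j) → E x = m.E x) ∧
      BlockInv u m.a m.L m.b m.i m.F E ∧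
      (ans = m.ans ∨ ans = 0 ∧ ¬ SquarefreeUpTo u m.n) ∧
      (ans ≠ 0 → ∀ r, Border u m.a m.i r → m.L ≤ r → r ≤ m.q →
        ∃ l, IsLeftExt u m.a m.L (m.i - r) l ∧ l + r < m.i - r) ∧
      t ≤ 100 * (m.q / m.L) + 100 +
        (if m.L ≤ m.q ∧ Border u m.a m.i m.L then 1000 * m.L else 0) := by
  induction hk : m.q using Nat.strong_induction_on generalizing m with
  | _ k ih =>
  have hq0 := hq.1
  have := hok.size
  have := hok.word
  have := hok.b
  have := hok.L
  refine Wp.while (by simp; omega) (fun h => ?_) (fun h => ?_)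
  · simp at h
    refine Wp.seq (Wp.assign (by simp; omega) (Wp.seq ?_))
    simp only [Mem.setVar_9, Expr.eval, BinOp.eval, Mem.st_var_6, Mem.st_var_8]
    refine (wp_recordLeft (u := u) (m := { m with p := m.i - m.q })
      { hok with p := by show m.i - m.q ≤ m.n; omega } hT
      (by show m.a + (m.i - m.q) ≤ m.n; omega)).mono ?_
    rintro s' t ⟨l, E, rfl, hl, hEn, hE', h1, h2⟩
    simp only at hl hEn hE' h1 h2
    -- For `q > L` the block recurred at distance `i - q` and that occurrence was completed at an
    -- earlier letter, so its extension is already stored.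
    have hx : IsLeftExt u m.a m.L (m.i - m.q) (E (m.b + (m.i - m.q))) := by
      rcases h.eq_or_lt with h3 | h3
      · exact (h2 h3.symm).1
      · rw [(h1 h3.ne').1]
        refine hE _ (by omega) (Or.inl (by omega)) ⟨by omega, fun j hj => ?_⟩
        rw [hq.2 j (by omega)]
        congr 1; omega
    have hx1 := hx.1
    have hx2 := hx.2.1
    have hF1 := hF m.q (by omega) (by omega)
    have hlt := maxBorder_lt (u := u) (a := m.a) (i := m.q) (by omega)
    have hb' := border_maxBorder (u := u) (a := m.a) (i := m.q) (by omega)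
    have hhalf := SquarefreeUpTo.two_mul_border_lt (hu.mono (by omega)) hb'
    -- the test for a square and the move to the next border
    have key : Wp M W (.ite
        (.lt (.bin .add (.get 1 (.bin .add (.var 7) (.var 9))) (.var 8)) (.var 9)) .skip
          (.assign 0 (.lit 0))) { m with p := m.i - m.q, l := l, E := E }.st fun s' t =>
        ∃ ans, s' = { m with ans := ans, p := m.i - m.q, l := l, E := E }.st ∧
          (ans = m.ans ∨ ans = 0 ∧ ¬ SquarefreeUpTo u m.n) ∧
          (ans ≠ 0 → E (m.b + (m.i - m.q)) + m.q < m.i - m.q) ∧ t ≤ 15 := by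
      refine Wp.ite (by simp; omega) (fun h => ?_) (fun h => ?_)
      · simp at h
        exact Wp.skip ⟨m.ans, rfl, Or.inl rfl, fun _ => h, by simp⟩
      · simp at h
        refine Wp.assign (by simp; omega) ⟨0, by simp, Or.inr ⟨rfl, ?_⟩, by simp, by simp⟩
        rw [← hn]
        exact not_squarefreeUpTo_of_leftExt hq hx (by omega)
    refine Wp.seq (key.mono ?_)
    rintro s' t' ⟨ans, rfl, hans, hans', ht'⟩
    refine Wp.assign (by simp; omega) ?_
    simp only [Mem.setVar_8, Expr.eval, BinOp.eval, Mem.st_var_7, Mem.st_var_8, Mem.st_arr_0, hF1]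
    refine (@ih (maxBorder u m.a m.q) (by omega)
      { m with ans := ans, p := m.i - m.q, l := l, E := E, q := maxBorder u m.a m.q }
      { hok with
        ans := by
          have := hok.ans
          show ans ≤ 1
          omega
        p := by show m.i - m.q ≤ m.n; omega
        l := hl
        E := hEn
        q := by show maxBorder u m.a m.q ≤ m.n; omega } hu hT hn hL hi hi8 hF ?_
      (hq.trans hb') rfl).mono ?_
    · intro p hp1 hp2 hp3
      simp only at hp2 hp3 ⊢
      by_cases hpp : p = m.i - m.q
      · rw [hpp]; exact hx
      · rw [hE' _ (by omega)]
        refine hE p hp1 (hp2.imp id fun h4 => ⟨h4.1, ?_⟩) hp3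
        -- This case is vacuous: a border of length `L < q` is still ahead in the chain, so the next
        -- border cannot be shorter than `L`.
        have h5 := (hq.nested (h4.1 ▸ hp3) (by omega)).le_maxBorder
        omega
    · rintro s' t'' ⟨ans', q', p', l', E', rfl, h3, h4, h5, h6, h7, h8⟩
      refine ⟨ans', q', p', l', E', rfl, h3, ?_, h5, ?_, ?_, ?_⟩
      · intro x hx
        rw [h4 x hx]
        exact hE' x (hx _ (by omega))
      · simp only at h6
        rcases h6 with rfl | h6
        · exact hans
        · exact Or.inr h6
      · intro h0 r hr1 hr2 hr3
        rcases (show r ≤ m.q by omega).lt_or_eq with h9 | rfl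
        · exact h7 h0 r hr1 hr2 (hq.nested hr1 h9).le_maxBorder
        · refine ⟨_, hx, hans' ?_⟩
          simp only at h6
          rcases h6 with rfl | h6
          · exact h0
          · exact absurd h6.1 h0
      · have hdiv : maxBorder u m.a m.q / m.L + 1 ≤ m.q / m.L := by
          rcases lt_or_ge (maxBorder u m.a m.q) m.L with h9 | h9
          · rw [Nat.div_eq_of_lt h9]
            exact (Nat.one_le_div_iff hL).2 h
          · rw [← Nat.add_div_right _ hL]
            exact Nat.div_le_div_right (by omega)
        simp only at h8
        -- For `q = L` the scan is charged here, and not again later because the next border is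
        -- shorter than `L`.
        rcases h.eq_or_lt with h9 | h9
        · have := (h2 h9.symm).2
          rw [if_neg (by omega)] at h8
          rw [if_pos ⟨by omega, h9 ▸ hq⟩]
          simp at *
          rw [← hk]
          omega
        · have := (h1 h9.ne').2
          have hif : (if m.L ≤ maxBorder u m.a m.q ∧ Border u m.a m.i m.L then 1000 * m.L else 0)
              ≤ if m.L ≤ k ∧ Border u m.a m.i m.L then 1000 * m.L else 0 := by
            by_cases hb : m.L ≤ maxBorder u m.a m.q ∧ Border u m.a m.i m.L
            · rw [if_pos hb, if_pos ⟨by omega, hb.2⟩]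
            · rw [if_neg hb]; exact Nat.zero_le _
          refine le_trans ?_ (Nat.add_le_add_left hif _)
          simp at *
          rw [← hk]
          omega
  · simp at h
    refine ⟨m.ans, m.q, m.p, m.l, m.E, rfl, hok, fun _ _ => rfl, ⟨hF, fun p h1 h2 h3 => ?_⟩,
      Or.inl rfl, fun _ r _ h1 h2 => by omega, by simp; omega⟩
    exact hE p h1 (by omega) h3

/-- The first cell of the memory region of the `c`-th block of length `L`. -/
def region (L c : ℕ) : ℕ := (c % 8 + 8) * (16 * L)

/-- No border of the active part of the `c`-th block of length `L` yields a square. -/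
def BlockClear (u : ℕ → Option α) (n L c : ℕ) : Prop :=
  ∀ r, Border u (c * L) (n - c * L) r → L ≤ r →
    ∃ l, IsLeftExt u (c * L) L (n - c * L - r) l ∧ l + r < n - c * L - r

/-- With `le_region`: regions of a level start between `128 * L` and `240 * L` and use `8 * L + 1`
cells, so the level ends before `128 * (2 * L)`, where the next one begins. -/
theorem region_le (L c : ℕ) : region L c ≤ 240 * L := by
  have : (c % 8 + 8) * (16 * L) ≤ 15 * (16 * L) := Nat.mul_le_mul_right _ (by omega)
  unfold region
  omega

theorem le_region (L c : ℕ) : 128 * L ≤ region L c := by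
  have : 8 * (16 * L) ≤ (c % 8 + 8) * (16 * L) := Nat.mul_le_mul_right _ (by omega)
  unfold region
  omega

open Classical in
theorem wp_processBlock {u : ℕ → Option α} {m : Mem α} (hok : m.Small M W)
    (hu : SquarefreeUpTo u (m.n - 1)) (hT : ∀ x < m.n, m.T x = u x) (hL : 0 < m.L)
    (hLn : m.L ≤ m.n) (hc : m.c * m.L < m.n) (hc8 : m.n ≤ m.c * m.L + 8 * m.L)
    (hB : BlockInv u (m.c * m.L) m.L (region m.L m.c) (m.n - 1 - m.c * m.L) m.F m.E) :
    Wp M W processBlock m.st fun s' t => ∃ m' : Mem α, s' = m'.st ∧ m'.Small M W ∧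
      (m'.n = m.n ∧ m'.L = m.L ∧ m'.c = m.c ∧ m'.lim = m.lim ∧ m'.T = m.T) ∧
      BlockInv u (m.c * m.L) m.L (region m.L m.c) (m.n - m.c * m.L) m'.F m'.E ∧
      (∀ x, (∀ j ≤ 8 * m.L, x ≠ region m.L m.c + j) → m'.F x = m.F x ∧ m'.E x = m.E x) ∧
      (m'.ans = m.ans ∨ m'.ans = 0 ∧ ¬ SquarefreeUpTo u m.n) ∧
      (m'.ans ≠ 0 → BlockClear u m.n m.L m.c) ∧
      t + 200 ≤ blockCost u (m.c * m.L) m.L (m.n - m.c * m.L) := by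
  have := hok.size
  have := hok.word
  have := hok.c
  have := region_le m.L m.c
  have hr : region m.L m.c = (m.c % 8 + 8) * (16 * m.L) := rfl
  have hset : Wp M W setBlock m.st fun s' t => s' = { m with
      a := m.c * m.L, i := m.n - m.c * m.L, b := region m.L m.c }.st ∧ t ≤ 30 := by
    refine Wp.seq (Wp.assign (by simp; omega) (Wp.seq ?_))
    simp only [Mem.setVar_5]
    refine Wp.assign (by simp; omega) ?_
    simp only [Mem.setVar_6]
    exact Wp.assign (by simp; omega) ⟨by simp [hr], by simp⟩
  refine Wp.seq (hset.mono ?_)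
  rintro s' t ⟨rfl, ht⟩
  obtain ⟨hB1, hB2⟩ := hB
  have hok' : Mem.Small { m with
      a := m.c * m.L, i := m.n - m.c * m.L, b := region m.L m.c } M W :=
    { hok with
      a := hc.le
      i := Nat.sub_le _ _
      b := by show region m.L m.c ≤ 240 * m.n; omega }
  have hi : 0 < m.n - m.c * m.L := by omega
  have hmb := maxBorder_lt (u := u) (a := m.c * m.L) hi
  refine Wp.seq ((wp_updateBorder (u := u) hok' hT (Nat.add_sub_of_le hc.le) hi
    fun j hj1 hj2 => hB1 j hj1 (by simp only at hj2; omega)).mono ?_)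
  rintro s' t' ⟨rfl, ht'⟩
  simp only at ht'
  refine (wp_checkBorders (u := u) (m := { m with
      a := m.c * m.L, i := m.n - m.c * m.L, b := region m.L m.c
      q := maxBorder u (m.c * m.L) (m.n - m.c * m.L)
      F := Function.update m.F (region m.L m.c + (m.n - m.c * m.L))
        (maxBorder u (m.c * m.L) (m.n - m.c * m.L)) })
    { hok' with
      q := by show maxBorder u (m.c * m.L) (m.n - m.c * m.L) ≤ m.n; omega
      F := ?_ } hu hT (Nat.add_sub_of_le hc.le) hL hi
      (by show m.n - m.c * m.L ≤ 8 * m.L; omega) ?_ ?_ (border_maxBorder hi)).mono ?_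
  · intro x
    by_cases hx : x = region m.L m.c + (m.n - m.c * m.L)
    · subst hx; simp; omega
    · simpa [hx] using hok.F x
  · intro j hj1 hj2
    simp only at hj2 ⊢
    by_cases hj : j = m.n - m.c * m.L
    · subst hj; simp
    · rw [Function.update_of_ne (by omega)]
      exact hB1 j hj1 (by omega)
  · intro p hp1 hp2 hp3
    simp only at hp2 hp3 ⊢
    rcases hp2 with hp2 | ⟨hp2, hp4⟩
    · exact hB2 p hp1 (by omega) hp3
    -- A border of length `L` contradicts the longest border being shorter than `L`.
    · rw [hp2] at hp3
      have := hp3.le_maxBorder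
      omega
  · rintro s' t'' ⟨ans, q, p, l, E, rfl, h1, h2, h3, h4, h5, h6⟩
    refine ⟨_, rfl, h1, ⟨rfl, rfl, rfl, rfl, rfl⟩, h3, fun x hx => ⟨?_, h2 x ?_⟩, h4, ?_, ?_⟩
    · simp only
      rw [Function.update_of_ne (hx _ (by omega))]
    · intro j hj
      simp only at hj
      exact hx j (by omega)
    · intro h0 r hr1 hr2
      exact h5 h0 r hr1 hr2 hr1.le_maxBorder
    · simp only at h6
      -- Fewer than eight border checks remain, so they fit into the constant part of `blockCost`.
      have h7 : maxBorder u (m.c * m.L) (m.n - m.c * m.L) / m.L < 8 :=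
        (Nat.div_lt_iff_lt_mul hL).2 (by omega)
      have h8 : (if m.L ≤ maxBorder u (m.c * m.L) (m.n - m.c * m.L) ∧
          Border u (m.c * m.L) (m.n - m.c * m.L) m.L then 1000 * m.L else 0) ≤
          if Border u (m.c * m.L) (m.n - m.c * m.L) m.L then 1000 * m.L else 0 := by
        split_ifs <;> simp_all
      unfold blockCost
      omega

/-! ### The work in one step -/

/-- The `c`-th block of length `2 ^ k` is active when `n` letters have been read. -/
def Active (k c n : ℕ) : Prop := 1 ≤ c ∧ c * 2 ^ k < n ∧ n ≤ c * 2 ^ k + 8 * 2 ^ k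

/-- Different levels are separated by position. Within a level, active indices differ by less than
8, so they have different residues and occupy different slots of width `16 * L`. -/
theorem Active.region_ne {k c k' c' n : ℕ} (h : Active k c n) (h' : Active k' c' n)
    (hne : ¬ (k = k' ∧ c = c')) {j j' : ℕ} (hj : j ≤ 8 * 2 ^ k) (hj' : j' ≤ 8 * 2 ^ k') :
    region (2 ^ k) c + j ≠ region (2 ^ k') c' + j' := by
  have key : ∀ k c k' c' j j', k < k' → j ≤ 8 * 2 ^ k →
      region (2 ^ k) c + j < region (2 ^ k') c' + j' := by
    intro k c k' c' j j' hk hj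
    have h1 := region_le (2 ^ k) c
    have h2 := le_region (2 ^ k') c'
    have h3 : 2 ^ (k + 1) ≤ 2 ^ k' := Nat.pow_le_pow_right (by norm_num) hk
    have h4 : 0 < 2 ^ k := by positivity
    rw [pow_succ] at h3
    omega
  rcases lt_trichotomy k k' with hk | rfl | hk
  · exact (key _ _ _ _ _ _ hk hj).ne
  · obtain ⟨-, h1, h2⟩ := h
    obtain ⟨-, h3, h4⟩ := h'
    have hL : 0 < 2 ^ k := by positivity
    unfold region
    generalize 2 ^ k = L at *
    rw [← add_mul] at h2 h4
    have h5 : c < c' + 8 := lt_of_mul_lt_mul_right (h1.trans_le h4) (Nat.zero_le L)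
    have h6 : c' < c + 8 := lt_of_mul_lt_mul_right (h3.trans_le h2) (Nat.zero_le L)
    have key' : ∀ x y j j' : ℕ, x < y → j ≤ 8 * L → x * (16 * L) + j < y * (16 * L) + j' := by
      intro x y j j' hxy hj
      have := Nat.mul_le_mul_right (16 * L) (Nat.succ_le_of_lt hxy)
      rw [Nat.succ_mul] at this
      omega
    rcases lt_trichotomy (c % 8 + 8) (c' % 8 + 8) with h7 | h7 | h7
    · exact (key' _ _ _ _ h7 hj).ne
    · exact absurd ⟨rfl, by omega⟩ hne
    · exact (key' _ _ _ _ h7 hj').ne'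
  · exact (key _ _ _ _ _ _ hk hj').ne'

theorem BlockInv.congr {u : ℕ → Option α} {a L b r : ℕ} {F E F' E' : ℕ → ℕ}
    (h : BlockInv u a L b r F E) (h' : ∀ j ≤ r, F' (b + j) = F (b + j) ∧ E' (b + j) = E (b + j)) :
    BlockInv u a L b r F' E' where
  border j h1 h2 := by rw [(h' j h2).1, h.border j h1 h2]
  left p h1 h2 h3 := by rw [(h' p (by omega)).2]; exact h.left p h1 h2 h3

/-- The invariant during a step: the active blocks in `D` are up to date, the others are in the
state they had before the last letter. -/
structure StepInv (M W : ℕ) (u : ℕ → Option α) (D : ℕ → ℕ → Prop) (m : Mem α) : Prop where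
  small : m.Small M W
  text : ∀ x < m.n, m.T x = u x
  done : ∀ k c, Active k c m.n → D k c →
    BlockInv u (c * 2 ^ k) (2 ^ k) (region (2 ^ k) c) (m.n - c * 2 ^ k) m.F m.E ∧
    (m.ans ≠ 0 → BlockClear u m.n (2 ^ k) c)
  todo : ∀ k c, Active k c m.n → ¬ D k c →
    BlockInv u (c * 2 ^ k) (2 ^ k) (region (2 ^ k) c) (m.n - 1 - c * 2 ^ k) m.F m.E
  sound : m.ans = 0 → ¬ SquarefreeUpTo u m.n

theorem StepInv.congr {u : ℕ → Option α} {D D' : ℕ → ℕ → Prop} {m m' : Mem α}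
    (h : StepInv M W u D m) (hs : m'.Small M W)
    (hm : m'.n = m.n ∧ m'.T = m.T ∧ m'.F = m.F ∧ m'.E = m.E ∧ m'.ans = m.ans)
    (hD : ∀ k c, Active k c m.n → (D k c ↔ D' k c)) : StepInv M W u D' m' := by
  obtain ⟨h1, h2, h3, h4, h5⟩ := hm
  constructor
  · exact hs
  · rw [h1, h2]; exact h.text
  · rw [h1, h3, h4, h5]; exact fun k c ha hd => h.done k c ha ((hD k c ha).2 hd)
  · rw [h1, h3, h4]; exact fun k c ha hd => h.todo k c ha (mt (hD k c ha).1 hd)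
  · rw [h1, h5]; exact h.sound

/-- Lifts the work on one block to the global invariant: by disjointness of regions the tables of
all other active blocks are untouched. -/
theorem wp_processBlock_step {u : ℕ → Option α} {m : Mem α} {D : ℕ → ℕ → Prop} {k : ℕ}
    (hm : StepInv M W u D m) (hu : SquarefreeUpTo u (m.n - 1)) (hL : m.L = 2 ^ k)
    (hLn : m.L ≤ m.n) (ha : Active k m.c m.n) (hD : ¬ D k m.c) :
    Wp M W processBlock m.st fun s' t => ∃ m' : Mem α, s' = m'.st ∧
      StepInv M W u (fun k' c' => D k' c' ∨ k' = k ∧ c' = m.c) m' ∧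
      (m'.n = m.n ∧ m'.L = m.L ∧ m'.c = m.c ∧ m'.lim = m.lim) ∧
      t + 200 ≤ blockCost u (m.c * 2 ^ k) (2 ^ k) (m.n - m.c * 2 ^ k) := by
  refine (wp_processBlock hm.small hu hm.text (by rw [hL]; positivity) hLn
    (by rw [hL]; exact ha.2.1) (by rw [hL]; exact ha.2.2)
    (by rw [hL]; exact hm.todo k m.c ha hD)).mono ?_
  rintro s' t ⟨m', rfl, h1, ⟨h2, h3, h4, h5, h6⟩, h7, h8, h9, h10, h11⟩
  rw [hL] at h7 h8 h10 h11
  have hframe : ∀ k' c', Active k' c' m.n → ¬ (k' = k ∧ c' = m.c) → ∀ j ≤ 8 * 2 ^ k',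
      m'.F (region (2 ^ k') c' + j) = m.F (region (2 ^ k') c' + j) ∧
      m'.E (region (2 ^ k') c' + j) = m.E (region (2 ^ k') c' + j) :=
    fun k' c' ha' hne j hj => h8 _ fun j' hj' => ha'.region_ne ha hne hj hj'
  refine ⟨m', rfl, ⟨h1, by rw [h2, h6]; exact hm.text, ?_, ?_, ?_⟩, ⟨h2, h3, h4, h5⟩, h11⟩
  · rw [h2]
    intro k' c' ha' hd
    by_cases hne : k' = k ∧ c' = m.c
    · obtain ⟨rfl, rfl⟩ := hne
      exact ⟨h7, h10⟩
    · obtain ⟨h12, h13⟩ := hm.done k' c' ha' (hd.resolve_right hne)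
      refine ⟨h12.congr fun j hj => hframe k' c' ha' hne j ?_, fun h0 => h13 ?_⟩
      · have := ha'.2.2
        omega
      · rcases h9 with h9 | h9
        · rwa [← h9]
        · exact absurd h9.1 h0
  · rw [h2]
    intro k' c' ha' hd
    rw [not_or] at hd
    refine (hm.todo k' c' ha' hd.1).congr fun j hj => hframe k' c' ha' hd.2 j ?_
    have := ha'.2.2
    omega
  · rw [h2]
    rintro h0
    rcases h9 with h9 | h9
    · exact hm.sound (by rw [← h9, h0])
    · exact h9.2

theorem wp_blockLoop {u : ℕ → Option α} {m : Mem α} {k : ℕ}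
    (hm : StepInv M W u (fun k' c' => k' < k ∨ k' = k ∧ m.c ≤ c') m)
    (hu : SquarefreeUpTo u (m.n - 1)) (hL : m.L = 2 ^ k) (hLn : m.L ≤ m.n)
    (hlim : 1 ≤ m.lim) (hlc : m.lim ≤ m.c)
    (ha : ∀ c, m.lim ≤ c → c < m.c → Active k c m.n) :
    Wp M W blockLoop m.st fun s' t => ∃ m' : Mem α, s' = m'.st ∧
      StepInv M W u (fun k' c' => k' < k ∨ k' = k ∧ m.lim ≤ c') m' ∧
      (m'.n = m.n ∧ m'.L = m.L) ∧
      t ≤ 10 + ∑ c ∈ Finset.Ico m.lim m.c, blockCost u (c * 2 ^ k) (2 ^ k) (m.n - c * 2 ^ k) := by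
  induction hd : m.c - m.lim using Nat.strong_induction_on generalizing m with
  | _ d ih =>
  have := hm.small.size
  have := hm.small.word
  have hc := hm.small.c
  have := hm.small.lim
  refine Wp.while (by simp; omega) (fun h => ?_) (fun h => ?_)
  · simp at h
    refine Wp.seq (Wp.assign (by simp; omega) ?_)
    simp only [Mem.setVar_3, Expr.eval, BinOp.eval, Mem.st_var_3]
    refine (wp_processBlock_step (m := { m with c := m.c - 1 }) (hm.congr
      { hm.small with c := by show m.c - 1 ≤ m.n; omega } ⟨rfl, rfl, rfl, rfl, rfl⟩
      fun _ _ _ => Iff.rfl) hu hL hLn (ha (m.c - 1) (by omega) (by omega)) ?_).mono ?_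
    · simp only
      omega
    rintro s' t ⟨m', rfl, h1, ⟨h2, h3, h4, h5⟩, h6⟩
    simp only at h1 h2 h3 h4 h5 h6
    refine (@ih (m'.c - m'.lim) (by omega) m' (h1.congr h1.small ⟨rfl, rfl, rfl, rfl, rfl⟩
      fun k' c' _ => ?_) (by rwa [h2]) (by rw [h3, hL]) (by rw [h2, h3]; exact hLn)
      (by omega) (by omega) (fun c hc1 hc2 => by rw [h2]; exact ha c (by omega) (by omega))
      rfl).mono ?_
    · rw [h4]
      omega
    · rintro s' t' ⟨m'', rfl, h7, ⟨h8, h9⟩, h10⟩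
      refine ⟨m'', rfl, ?_, ⟨by omega, by omega⟩, ?_⟩
      · rw [h5] at h7; exact h7
      · rw [h5, h4, h2] at h10
        obtain ⟨c, hc⟩ : ∃ c, m.c = c + 1 := ⟨m.c - 1, by omega⟩
        rw [hc, Finset.sum_Ico_succ_top (by omega)]
        simp only [hc, Nat.add_sub_cancel] at h6 h10
        simp at h6 ⊢
        omega
  · simp at h
    refine ⟨m, rfl, ?_, ⟨rfl, rfl⟩, by simp; omega⟩
    have : m.c = m.lim := by omega
    rw [this] at hm
    exact hm

theorem wp_processLevel {u : ℕ → Option α} {m : Mem α} {k : ℕ}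
    (hm : StepInv M W u (fun k' _ => k' < k) m)
    (hu : SquarefreeUpTo u (m.n - 1)) (hL : m.L = 2 ^ k) (hLn : m.L ≤ m.n) :
    Wp M W processLevel m.st fun s' t => ∃ m' : Mem α, s' = m'.st ∧
      StepInv M W u (fun k' _ => k' < k + 1) m' ∧
      (m'.n = m.n ∧ m'.L = 2 ^ (k + 1)) ∧ t + 20 ≤ levelCost u (2 ^ k) m.n := by
  have := hm.small.size
  have := hm.small.word
  have hpos : 0 < 2 ^ k := by positivity
  have hdiv := Nat.div_le_self (m.n - 1) m.L
  have e1 : ∀ c, c < (m.n - 1) / m.L + 1 ↔ c * 2 ^ k < m.n := by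
    intro c
    rw [Nat.lt_succ_iff, hL, Nat.le_div_iff_mul_le hpos]
    omega
  have e2 : ∀ c, 1 + ((m.n - 1) / m.L + 1 - 9) ≤ c ↔ 1 ≤ c ∧ m.n ≤ c * 2 ^ k + 8 * 2 ^ k := by
    intro c
    have : (m.n - 1) / m.L < c + 8 ↔ m.n - 1 < (c + 8) * 2 ^ k := by
      rw [hL, Nat.div_lt_iff_lt_mul hpos]
    rw [add_mul] at this
    omega
  have e3 : ∀ c, Active k c m.n ↔ 1 + ((m.n - 1) / m.L + 1 - 9) ≤ c ∧ c < (m.n - 1) / m.L + 1 := by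
    intro c
    rw [e1, e2, Active]
    tauto
  refine Wp.seq (Wp.assign (by simp; omega) (Wp.seq (Wp.assign (by simp; omega) (Wp.seq ?_))))
  simp only [Mem.setVar_3, Mem.setVar_4, Expr.eval, BinOp.eval, Mem.st_var_3, Mem.st_var_1,
    Mem.st_var_2]
  have hlim : ∀ x, 1 + (x + 1 - 9) ≤ x + 1 := by omega
  refine (wp_blockLoop (k := k) (m := { m with
    c := (m.n - 1) / m.L + 1, lim := 1 + ((m.n - 1) / m.L + 1 - 9) }) (hm.congr
      { hm.small with
        c := by show (m.n - 1) / m.L + 1 ≤ m.n; omega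
        lim := by show 1 + ((m.n - 1) / m.L + 1 - 9) ≤ m.n; omega }
      ⟨rfl, rfl, rfl, rfl, rfl⟩ fun k' c' hac => ?_) hu hL hLn
      (by show 1 ≤ 1 + _; omega) (hlim _)
      fun c hc1 hc2 => (e3 c).2 ⟨hc1, hc2⟩).mono ?_
  · constructor
    · exact Or.inl
    · rintro (h | ⟨rfl, h⟩)
      · exact h
      · have := ((e3 c').1 hac).2
        simp only at h
        omega
  · rintro s' t ⟨m', rfl, h1, ⟨h2, h3⟩, h4⟩
    simp only at h1 h2 h3 h4
    have := h1.small.size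
    have := h1.small.word
    refine Wp.assign (by simp; omega) ?_
    simp only [Mem.setVar_2, Expr.eval, BinOp.eval, Mem.st_var_2]
    refine ⟨_, rfl, h1.congr { h1.small with L := ?_ } ⟨rfl, rfl, rfl, rfl, rfl⟩
      fun k' c' hac => ?_, ⟨h2, ?_⟩, ?_⟩
    · show 2 * m'.L ≤ 2 * m'.n
      omega
    · rw [h2] at hac
      constructor
      · omega
      · intro h
        rcases Nat.lt_succ_iff_lt_or_eq.1 h with h | rfl
        · exact Or.inl h
        · exact Or.inr ⟨rfl, ((e3 c').1 hac).1⟩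
    · simp only
      rw [h3, hL, pow_succ, mul_comm]
    · unfold levelCost activeBlocks
      rw [hL] at h4
      simp only [Expr.cost]
      omega

theorem wp_levelLoop {u : ℕ → Option α} {m : Mem α} {k : ℕ}
    (hm : StepInv M W u (fun k' _ => k' < k) m)
    (hu : SquarefreeUpTo u (m.n - 1)) (hL : m.L = 2 ^ k) (hn : 0 < m.n)
    (hk : k ≤ Nat.log 2 m.n + 1) :
    Wp M W levelLoop m.st fun s' t => ∃ m' : Mem α, s' = m'.st ∧ StepInv M W u (fun _ _ => True) m' ∧
      m'.n = m.n ∧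
      t ≤ 10 + ∑ k' ∈ Finset.Ico k (Nat.log 2 m.n + 1), levelCost u (2 ^ k') m.n := by
  induction hd : Nat.log 2 m.n + 1 - k using Nat.strong_induction_on generalizing m k with
  | _ d ih =>
  have := hm.small.size
  have := hm.small.word
  have := hm.small.L
  refine Wp.while (by simp; omega) (fun h => ?_) (fun h => ?_)
  · simp at h
    refine (wp_processLevel hm hu hL h).mono ?_
    rintro s' t ⟨m', rfl, h1, ⟨h2, h3⟩, h4⟩
    rw [hL] at h
    have hk' : k ≤ Nat.log 2 m.n := (Nat.le_log_iff_pow_le (by norm_num) hn.ne').2 h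
    refine (@ih (Nat.log 2 m'.n + 1 - (k + 1)) (by rw [h2]; omega) m' (k + 1) h1 (by rwa [h2]) h3
      (by rwa [h2]) (by rw [h2]; omega) rfl).mono ?_
    rintro s' t' ⟨m'', rfl, h5, h6, h7⟩
    refine ⟨m'', rfl, h5, by omega, ?_⟩
    rw [h2] at h7
    rw [Finset.sum_eq_sum_Ico_succ_bot (by omega)]
    simp
    omega
  · simp at h
    rw [hL] at h
    refine ⟨m, rfl, hm.congr hm.small ⟨rfl, rfl, rfl, rfl, rfl⟩ fun k' c' hac => ?_, rfl,
      by simp; omega⟩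
    simp only [iff_true]
    -- The loop has ended with `n < 2 ^ k`. An active block has `c ≥ 1`, so its length is less than
    -- `n` and its level has been processed.
    have h1 : 2 ^ k' < 2 ^ k := lt_of_le_of_lt
      (Nat.le_mul_of_pos_left _ hac.1) (hac.2.1.trans h)
    exact (Nat.pow_lt_pow_iff_right (by norm_num)).1 h1

/-- The invariant between two steps, as long as no square has been read. -/
structure PrefixInv (M W : ℕ) (u : ℕ → Option α) (m : Mem α) : Prop where
  small : m.Small M W
  text : ∀ x < m.n, m.T x = u x
  block : ∀ k c, Active k c m.n →
    BlockInv u (c * 2 ^ k) (2 ^ k) (region (2 ^ k) c) (m.n - c * 2 ^ k) m.F m.E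
  ans : m.ans ≠ 0

/-- A new square must end at the newest letter and cannot start at the empty cell 0, so an active
block sees it, contradicting that all active blocks are clear. -/
theorem StepInv.squarefree_iff {u : ℕ → Option α} {m : Mem α}
    (h : StepInv M W u (fun _ _ => True) m) (hu : SquarefreeUpTo u (m.n - 1))
    (hu0 : u 0 = none) (hus : ∀ x, 1 ≤ x → x < m.n → u x ≠ none) :
    m.ans ≠ 0 ↔ SquarefreeUpTo u m.n := by
  refine ⟨fun h0 s p hp hs hsq => ?_, fun h0 h1 => h.sound h1 h0⟩
  by_cases hn : s + 2 * p ≤ m.n - 1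
  · exact hu s p hp hn hsq
  have hs0 : 0 < s := by
    by_contra hs0
    have := hsq 0 hp
    rw [show s + 0 = 0 by omega, hu0] at this
    exact hus _ (by omega) (by omega) this.symm
  obtain ⟨k, c, hc, h1, h2, q, hq, hLq, hext⟩ :=
    exists_block_of_square (n := m.n) hs0 hp (by omega) hsq
  obtain ⟨l, hl, hlt⟩ := (h.done k c ⟨hc, h1, h2⟩ trivial).2 h0 q hq hLq
  have := hext l hl
  omega

theorem wp_step {u : ℕ → Option α} {m : Mem α} {a : α} (hm : PrefixInv M W u m) (hn : 0 < m.n)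
    (hM : 300 * (m.n + 2) ≤ M) (hW : 300 * (m.n + 2) ≤ W) (ha : u m.n = some a)
    (hu : SquarefreeUpTo u m.n) (hu0 : u 0 = none) (hus : ∀ x, 1 ≤ x → x < m.n → u x ≠ none) :
    Wp M W squareDetector.step (m.st.setLVar 0 (some a)) fun s' t => ∃ m' : Mem α, s' = m'.st ∧
      m'.n = m.n + 1 ∧ (SquarefreeUpTo u (m.n + 1) → PrefixInv M W u m') ∧
      (m'.ans ≠ 0 ↔ SquarefreeUpTo u (m.n + 1)) ∧ t + 1 ≤ stepCost u (m.n + 1) := by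
  have hans := hm.ans
  have hans1 := hm.small.ans
  rw [Mem.setLVar_0]
  refine Wp.ite (by simp; omega) (fun h => absurd h (by simp [hans])) (fun _ => ?_)
  refine Wp.seq (Wp.lstore (by simp; omega) (Wp.seq ?_))
  simp only [Mem.setLArr_0, Expr.eval, LExpr.eval, Mem.st_var_1, Mem.st_lvar_0]
  refine Wp.assign (by simp; omega) (Wp.seq ?_)
  simp only [Mem.setVar_1, Expr.eval, BinOp.eval, Mem.st_var_1]
  refine Wp.assign (by simp; omega) ?_
  simp only [Mem.setVar_2, Expr.eval]
  have hs := hm.small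
  refine (wp_levelLoop (u := u) (k := 0) (m := { m with
      inp := some a, T := Function.update m.T m.n (some a), n := m.n + 1, L := 1 })
    ⟨⟨hM, hW, hs.ans, ?_, hs.c.trans ?_, hs.lim.trans ?_, hs.a.trans ?_, hs.i.trans ?_,
      hs.b.trans ?_, hs.q.trans ?_, hs.p.trans ?_, hs.l.trans ?_, fun x => (hs.F x).trans ?_,
      fun x => (hs.E x).trans ?_⟩, fun x hx => ?_, fun k c _ h => absurd h (by omega),
      fun k c hac _ => ?_, fun h => absurd h hans⟩
    hu rfl (Nat.succ_pos _) (Nat.zero_le _)).mono ?_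
  any_goals (simp only; omega)
  · simp only at hx ⊢
    by_cases hxn : x = m.n
    · subst hxn; simp [ha]
    · rw [Function.update_of_ne hxn]
      exact hm.text x (by omega)
  · simp only [Nat.add_sub_cancel]
    obtain ⟨h1, h2, h3⟩ := hac
    simp only at h2 h3
    by_cases h4 : c * 2 ^ k < m.n
    · exact hm.block k c ⟨h1, h4, by omega⟩
    -- The block starts at the newest letter; none of its letters had been read before, so nothing
    -- is required of its tables.
    · exact ⟨fun j _ _ => by omega, fun p _ _ => by omega⟩
  · rintro s' t ⟨m', rfl, h1, h2, h3⟩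
    simp only at h2 h3
    have key := h1.squarefree_iff (by rw [h2]; exact hu) hu0 (by
      intro x hx1 hx2
      by_cases hxn : x = m.n
      · rw [hxn, ha]; simp
      · exact hus x hx1 (by omega))
    rw [h2] at key
    refine ⟨m', rfl, h2, fun h4 => ⟨h1.small, h1.text, fun k c hac => (h1.done k c hac trivial).1,
      key.2 h4⟩, key, ?_⟩
    unfold stepCost
    rw [Finset.range_eq_Ico]
    simp only [Expr.cost, LExpr.cost, Test.cost]
    omega

/-! ### From words to runs and the final bounds -/

/-- The word `w` as an infinite word, preceded by an empty cell. -/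
def textOf (w : List α) : ℕ → Option α
  | 0 => none
  | x + 1 => w[x]?

theorem squarefreeUpTo_textOf (w : List α) :
    SquarefreeUpTo (textOf w) (w.length + 1) ↔ SquarefreeWord w := by
  constructor
  · rintro h v ⟨y, z, rfl⟩ ⟨x, hx, rfl⟩
    refine h (y.length + 1) x.length (List.length_pos_iff.2 hx) (by simp; omega) fun j hj => ?_
    rw [show y.length + 1 + j = y.length + j + 1 by omega,
      show y.length + 1 + x.length + j = y.length + (x.length + j) + 1 by omega]
    simp only [textOf, List.append_assoc]
    rw [List.getElem?_append_right (Nat.le_add_right _ _),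
      List.getElem?_append_right (Nat.le_add_right _ _), Nat.add_sub_cancel_left,
      Nat.add_sub_cancel_left, List.getElem?_append_left hj,
      List.getElem?_append_right (Nat.le_add_right _ _), Nat.add_sub_cancel_left,
      List.getElem?_append_left hj]
  · intro h s p hp hs hsq
    rcases s with _ | s
    · have := hsq 0 hp
      obtain ⟨p, rfl⟩ : ∃ p', p = p' + 1 := ⟨p - 1, by omega⟩
      simp [textOf] at this
      omega
    · refine h ((w.drop s).take (p + p)) ?_ ⟨(w.drop s).take p, ?_, ?_⟩
      · exact ((List.take_prefix _ _).isInfix).trans (List.drop_suffix _ _).isInfix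
      · intro h0
        have := congrArg List.length h0
        simp at this
        omega
      · rw [List.take_add]
        congr 1
        refine List.ext_getElem? fun j => ?_
        simp only [List.getElem?_take, List.getElem?_drop]
        split_ifs with hj
        · have := hsq j hj
          rw [show s + 1 + j = s + j + 1 by omega,
            show s + 1 + p + j = s + (p + j) + 1 by omega] at this
          simp only [textOf] at this
          exact this.symm
        · rfl

/-- The sharp sum of step costs is carried only while the text is squarefree. Beyond the first
square only `totalBound` is kept, whose growth covers the constant work of each further step. -/
theorem exists_run (w : List α) (hM : 300 * (w.length + 2) ≤ M) (hW : 300 * (w.length + 2) ≤ W)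
    (j : ℕ) (hj : j ≤ w.length) :
    ∃ (m : Mem α) (t : ℕ), squareDetector.Run M W (w.take j) m.st t ∧
      (m.ans ≠ 0 ↔ SquarefreeUpTo (textOf w) (j + 1)) ∧ t ≤ totalBound (j + 1) ∧
      (SquarefreeUpTo (textOf w) (j + 1) → PrefixInv M W (textOf w) m ∧ m.n = j + 1 ∧
        t ≤ ∑ i ∈ Finset.range (j + 1), stepCost (textOf w) (i + 1)) := by
  induction j with
  | zero =>
    have hu : SquarefreeUpTo (textOf w) 1 := fun s p hp hs => by omega
    have hsum := sum_stepCost_le (n := 1) (hu.mono (Nat.sub_le _ _))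
    have h100 : 100 ≤ stepCost (textOf w) 1 := Nat.le_add_right _ _
    have hrun : Wp M W squareDetector.start (State.blank α) fun s' t =>
        s' = { Mem.blank α with ans := 1, n := 1 }.st ∧ t = 4 := by
      rw [← Mem.st_blank]
      refine Wp.seq (Wp.assign (by simp; omega) (Wp.assign (by simp; omega) ?_))
      exact ⟨by simp, by simp⟩
    obtain ⟨_, _, he, rfl, rfl⟩ := hrun
    simp only [Finset.sum_range_one, zero_add] at hsum ⊢
    refine ⟨_, _, .nil he, ⟨fun _ => hu, fun _ => one_ne_zero⟩, by omega, fun _ =>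
      ⟨⟨?_, ?_, ?_, one_ne_zero⟩, rfl, by omega⟩⟩
    · constructor <;> simp [Mem.blank] <;> omega
    · intro x hx
      obtain rfl : x = 0 := by simp only at hx; omega
      rfl
    · rintro k c ⟨h1, h2, -⟩
      have := Nat.mul_le_mul h1 (Nat.one_le_two_pow (n := k))
      simp only at h2
      omega
  | succ j ih =>
    obtain ⟨m, t, hrun, hans, ht, hsq⟩ := ih (by omega)
    have htake : w.take (j + 1) = w.take j ++ [w[j]] := (List.take_append_getElem hj).symm
    rw [htake]
    by_cases hu : SquarefreeUpTo (textOf w) (j + 1)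
    · obtain ⟨hm, hn, ht⟩ := hsq hu
      obtain ⟨_, t', he, m', rfl, h1, h2, h3, h4⟩ := wp_step (a := w[j]) hm (by omega)
        (by omega) (by omega) (by rw [hn]; simp [textOf]) (by rwa [hn]) rfl (by
          intro x hx1 hx2
          obtain ⟨x, rfl⟩ : ∃ x', x = x' + 1 := ⟨x - 1, by omega⟩
          simp [textOf]
          omega)
      rw [hn] at h1 h2 h3 h4
      have hsum := sum_stepCost_le (n := j + 1 + 1) hu
      rw [Finset.sum_range_succ] at hsum
      refine ⟨m', _, .snoc hrun he, h3, by omega, fun h5 => ⟨h2 h5, h1, ?_⟩⟩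
      rw [Finset.sum_range_succ]
      omega
    · have h0 : m.ans = 0 := by
        by_contra h0
        exact hu (hans.1 h0)
      have hu' : ¬ SquarefreeUpTo (textOf w) (j + 1 + 1) := fun h => hu (h.mono (Nat.le_succ _))
      have hstep : Wp M W squareDetector.step (m.st.setLVar 0 (some w[j])) fun s' t =>
          s' = { m with inp := some w[j] }.st ∧ t ≤ 10 := by
        rw [Mem.setLVar_0]
        refine Wp.ite (by simp; omega) (fun _ => Wp.skip ⟨rfl, by simp⟩)
          fun h => absurd h (by simp [h0])
      obtain ⟨_, t', he, rfl, ht'⟩ := hstep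
      have := totalBound_succ (j + 1)
      exact ⟨_, _, .snoc hrun he, ⟨fun h => absurd h0 h, fun h => absurd h hu'⟩, by omega,
        fun h => absurd h hu'⟩

/-- For `n ≥ 2`, `n + 1 ≤ 2 * n` and `Nat.log 2 (n + 1) + 2 ≤ 4 * Nat.log 2 n`; passing to the
natural logarithm costs a factor 2 because `log 2 ≥ 1 / 2`. -/
theorem totalBound_le {n : ℕ} (hn : 2 ≤ n) :
    (totalBound (n + 1) : ℝ) ≤ 480000 * ((n : ℝ) * Real.log n) := by
  have h1 : Nat.log 2 (n + 1) ≤ Nat.log 2 n + 1 := by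
    rw [← Nat.log_mul_base (by norm_num) (by omega)]
    exact Nat.log_mono_right (by omega)
  have h2 : 1 ≤ Nat.log 2 n := Nat.log_pos (by norm_num) hn
  have h3 : totalBound (n + 1) ≤ 240000 * (n * Nat.log 2 n) := by
    unfold totalBound
    calc (n + 1) * (30000 * (Nat.log 2 (n + 1) + 2)) ≤ (2 * n) * (30000 * (4 * Nat.log 2 n)) :=
          Nat.mul_le_mul (by omega) (by omega)
      _ = 240000 * (n * Nat.log 2 n) := by ring
  have h4 : (Nat.log 2 n : ℝ) ≤ 2 * Real.log n := by
    have h5 : ((2 ^ Nat.log 2 n : ℕ) : ℝ) ≤ n := by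
      exact_mod_cast Nat.pow_log_le_self 2 (by omega)
    have h6 := Real.log_le_log (by positivity) h5
    rw [Nat.cast_pow, Real.log_pow, Nat.cast_ofNat] at h6
    have h7 : (1 / 2 : ℝ) ≤ Real.log 2 := by
      have := Real.log_two_gt_d9
      linarith
    have h8 := mul_le_mul_of_nonneg_left h7 (Nat.cast_nonneg (α := ℝ) (Nat.log 2 n))
    linarith
  have h5 : (totalBound (n + 1) : ℝ) ≤ 240000 * (n * Nat.log 2 n) := by exact_mod_cast h3
  have h6 := mul_le_mul_of_nonneg_left h4 (Nat.cast_nonneg (α := ℝ) n)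
  linarith

end OnlineSquares

theorem mainTheorem1 :
    ∃ (A : OnlineSquares.OnlineAlgorithm) (C : ℕ), ∀ (α : Type*) (w : List α),
      ∃ (s : OnlineSquares.State α) (t : ℕ),
        A.Run (C * (w.length + 1)) ((w.length + 2) ^ C) w s t ∧
        (s.var A.answer ≠ 0 ↔ OnlineSquares.SquarefreeWord w) ∧
        (2 ≤ w.length → (t : ℝ) ≤ (C : ℝ) * ((w.length : ℝ) * Real.log (w.length : ℝ))) := by
  -- The constant of the time bound also covers space and word size. It is kept opaque so that the
  -- power with exponent `C` is never evaluated.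
  obtain ⟨C, hC⟩ : ∃ C : ℕ, C = 480000 := ⟨_, rfl⟩
  refine ⟨OnlineSquares.squareDetector, C, fun α w => ?_⟩
  have hW : 300 * (w.length + 2) ≤ (w.length + 2) ^ C := by
    calc 300 * (w.length + 2) ≤ 2 ^ 9 * (w.length + 2) := Nat.mul_le_mul_right _ (by norm_num)
      _ ≤ (w.length + 2) ^ 9 * (w.length + 2) :=
        Nat.mul_le_mul_right _ (Nat.pow_le_pow_left (by omega) _)
      _ = (w.length + 2) ^ 10 := (pow_succ _ _).symm
      _ ≤ (w.length + 2) ^ C := Nat.pow_le_pow_right (by omega) (by omega)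
  obtain ⟨m, t, hrun, hans, ht, -⟩ := OnlineSquares.exists_run (M := C * (w.length + 1)) w
    (by rw [hC]; omega) hW w.length le_rfl
  rw [List.take_length] at hrun
  refine ⟨m.st, t, hrun, hans.trans (OnlineSquares.squarefreeUpTo_textOf w), fun hn => ?_⟩
  have h1 : (t : ℝ) ≤ OnlineSquares.totalBound (w.length + 1) := by exact_mod_cast ht
  have h2 := OnlineSquares.totalBound_le hn
  rw [hC]
  push_cast
  exact h1.trans h2
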